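/- **Definitions.** A *coarse median space of rank at most $r$* is a metric space $(X,d)$ with a map $m:X^3\to X$ and a function $h:\mathbb{N}\to\mathbb{N}$ such that (1) $d(m(x,y,z),m(x',y',z'))\le h(1)\,(d(x,x')+d(y,y')+d(z,z'))+h(0)$ for all $x,y,z,x',y',z'\in X$; and (2) for every $n$ and every nonempty $A\subseteq X$ with $|A|\le n$ there are a finite CAT(0) cube complex $Q$ of dimension at most $r$, with vertex median $m_Q$, and maps $f:Q^{(0)}\to X$, $g:A\to Q^{(0)}$ with $d(f(m_Q(a,b,c)),m(f(a),f(b),f(c)))\le h(n)$ for all vertices $a,b,c$ of $Q$ and $d(a,f(g(a)))\le h(n)$ for all $a\in A$. For $A\subseteq X$ put $J(A)=\bigcup_{x,y\in A}\{m(x,y,z): z\in X\}$; the *median hull* of $A$ is $\mathrm{hull}(A)=J^r(A)$, the $r$-fold iterate. A subset $H\subseteq X$ *admits a $(v,K)$-cubical approximation* if there are a (nonempty) CAT(0) cube complex $Q$ of dimension at most $v$, with vertex set $Q^{(0)}$, combinatorial metric $d_Q$ and median $m_Q$, and a $K$-median $(K,K)$-quasi-isometry $f:Q^{(0)}\to H$,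 i.e. $d(f(m_Q(a,b,c)),m(f(a),f(b),f(c)))<K$ and $\frac1K d_Q(a,b)-K\le d(f(a),f(b))\le K d_Q(a,b)+K$ for all vertices $a,b,c$, and every point of $H$ is at distance at most $K$ from $f(Q^{(0)})$. The space $X$ is *locally quasi-cubical (LQC) of dimension $v$*, with parameters $h$, $r$ and $k:\mathbb{N}\to\mathbb{R}$, if it is a coarse median space of rank at most $r$ with function $h$, and $\mathrm{hull}(F)$ admits a $(v,k(|F|))$-cubical approximation for every nonempty finite $F\subseteq X$. For $\lambda\ge1$, a *$\lambda$-median ray* is a map $\gamma:[0,\infty)\to X$ with $\frac1\lambda|s-t|-\lambda\le d(\gamma(s),\gamma(t))\le\lambda|s-t|+\lambda$ for all $s,t$ and $d(\gamma(b),m(\gamma(a_1),\gamma(a_2),\gamma(a_3)))<\lambda$ for all $a_1,a_2,a_3\ge0$, where $b$ is the middle one of $a_1,a_2,a_3$. **Theorem.** Let $\lambda\ge 1$, let $m,n\ge0$ be integers with $m+n\ge1$, and let LQC parameters $h,r,k$ and a dimension $v$ be given. There is a constant $K$, depending only on $\lambda,m,n$ and $h,r,k,v$, such that for every proper LQC space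 $X$ of dimension $v$ with these parameters, all points $x_1,\dots,x_m\in X$ and all $\lambda$-median rays $\gamma_1,\dots,\gamma_n$ in $X$, the median hull of $\gamma_1\cup\dots\cup\gamma_n\cup\{x_1,\dots,x_m\}$ admits a $(v,K)$-cubical approximation. -/

import Mathlib

open scoped NNReal

universe u

namespace LQC

/-! ### Cube complexes -/

/-- A map `{0,1}^k → {0,1}^n` which preserves the Hamming distance; equivalently, the restriction to
vertices of an isometry from the cube `[0,1]^k` onto a `k`-dimensional face of `[0,1]^n`. -/
def IsFaceMap {k n : ℕ} (φ : (Fin k → Bool) → (Fin n → Bool)) : Prop :=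
  ∀ a b, hammingDist (φ a) (φ b) = hammingDist a b

/-- A cube complex with vertex set `V`: unit cubes glued along faces by isometries, where every cube
is embedded and two cubes which meet do so in a common face. `IsCube n c` says that
`c : {0,1}^n → V` is the restriction to vertices of the characteristic map of an `n`-cube,
in one of its parametrizations. -/
structure CubeComplex (V : Type u) where
  IsCube : (n : ℕ) → ((Fin n → Bool) → V) → Prop
  injective : ∀ {n : ℕ} {c : (Fin n → Bool) → V}, IsCube n c → Function.Injective c
  vertex : ∀ x : V, IsCube 0 (fun _ => x)
  face : ∀ {n k : ℕ} {c : (Fin n → Bool) → V} {φ : (Fin k → Bool) → (Fin n → Bool)},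
    IsCube n c → IsFaceMap φ → IsCube k (c ∘ φ)
  inter : ∀ {n n' : ℕ} {c : (Fin n → Bool) → V} {c' : (Fin n' → Bool) → V},
    IsCube n c → IsCube n' c' → (Set.range c ∩ Set.range c').Nonempty →
    ∃ (k : ℕ) (φ : (Fin k → Bool) → (Fin n → Bool)) (φ' : (Fin k → Bool) → (Fin n' → Bool)),
      IsFaceMap φ ∧ IsFaceMap φ' ∧ c ∘ φ = c' ∘ φ' ∧
      Set.range c ∩ Set.range c' = Set.range (c ∘ φ)

namespace CubeComplex

variable {V : Type u}

/-- The 1-skeleton. -/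
def skeleton (Q : CubeComplex V) : SimpleGraph V where
  Adj x y := ∃ c : (Fin 1 → Bool) → V, Q.IsCube 1 c ∧ c ![false] = x ∧ c ![true] = y
  symm := ⟨by
    rintro x y ⟨c, hc, hx, hy⟩
    refine ⟨c ∘ fun a i => !(a i), Q.face hc ?_, ?_, ?_⟩
    · intro a b
      simp [hammingDist]
    · rw [← hy]
      simp only [Function.comp_apply]
      congr 1
      ext i
      fin_cases i
      simp
    · rw [← hx]
      simp only [Function.comp_apply]
      congr 1
      ext i
      fin_cases i
      simp⟩
  loopless := ⟨by
    rintro x ⟨c, hc, hx, hy⟩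
    have h := congrFun (Q.injective hc (hx.trans hy.symm)) 0
    simp at h⟩

/-- `x, y, z, w` are, in cyclic order, the vertices of a 2-cube. -/
def IsSquare (Q : CubeComplex V) (x y z w : V) : Prop :=
  ∃ c : (Fin 2 → Bool) → V, Q.IsCube 2 c ∧ c ![false, false] = x ∧ c ![true, false] = y ∧
    c ![true, true] = z ∧ c ![false, true] = w

/-- Homotopy of edge paths relative to the endpoints: the congruence generated by removing
backtracks and by pushing two consecutive edges of a 2-cube across that 2-cube. -/
inductive PathHomotopic (Q : CubeComplex V) :
    {x y : V} → Q.skeleton.Walk x y → Q.skeleton.Walk x y → Prop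
  | refl {x y : V} (p : Q.skeleton.Walk x y) : PathHomotopic Q p p
  | symm {x y : V} {p q : Q.skeleton.Walk x y} :
      PathHomotopic Q p q → PathHomotopic Q q p
  | trans {x y : V} {p q r : Q.skeleton.Walk x y} :
      PathHomotopic Q p q → PathHomotopic Q q r → PathHomotopic Q p r
  | cons {x y z : V} (e : Q.skeleton.Adj x y) {p q : Q.skeleton.Walk y z} :
      PathHomotopic Q p q → PathHomotopic Q (.cons e p) (.cons e q)
  | backtrack {x y z : V} (e : Q.skeleton.Adj x y) (p : Q.skeleton.Walk x z) :
      PathHomotopic Q (.cons e (.cons e.symm p)) p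
  | square {x y z w t : V} (_ : Q.IsSquare x y z w)
      (exy : Q.skeleton.Adj x y) (eyz : Q.skeleton.Adj y z)
      (exw : Q.skeleton.Adj x w) (ewz : Q.skeleton.Adj w z) (p : Q.skeleton.Walk z t) :
      PathHomotopic Q (.cons exy (.cons eyz p)) (.cons exw (.cons ewz p))

/-- Nonempty, connected, and every closed edge path is null-homotopic. -/
def SimplyConnected (Q : CubeComplex V) : Prop :=
  Q.skeleton.Connected ∧
    ∀ (x : V) (p : Q.skeleton.Walk x x), Q.PathHomotopic p .nil

/-- All vertex links are flag: finitely many edges at `x` which pairwise span a 2-cube at `x`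
are all contained in a single cube containing `x`. -/
def FlagLinks (Q : CubeComplex V) : Prop :=
  ∀ (x : V) (S : Finset V), (∀ y ∈ S, Q.skeleton.Adj x y) →
    (∀ y ∈ S, ∀ z ∈ S, y ≠ z → ∃ w, Q.IsSquare x y w z) →
    ∃ (n : ℕ) (c : (Fin n → Bool) → V), Q.IsCube n c ∧ x ∈ Set.range c ∧ (S : Set V) ⊆ Set.range c

/-- A CAT(0) cube complex: simply connected, with flag vertex links. -/
def IsCAT0 (Q : CubeComplex V) : Prop :=
  Q.SimplyConnected ∧ Q.FlagLinks

/-- Every cube has dimension at most `v`. -/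
def DimLE (Q : CubeComplex V) (v : ℕ) : Prop :=
  ∀ (n : ℕ) (c : (Fin n → Bool) → V), Q.IsCube n c → n ≤ v

/-- The combinatorial distance between two vertices. -/
noncomputable def cdist (Q : CubeComplex V) (x y : V) : ℝ := (Q.skeleton.dist x y : ℝ)

/-- `w` lies on combinatorial geodesics from `x` to `y`, from `y` to `z` and from `x` to `z`. In a
CAT(0) cube complex any three vertices `x, y, z` have exactly one such `w`, their median. -/
def IsMedian (Q : CubeComplex V) (x y z w : V) : Prop :=
  Q.cdist x w + Q.cdist w y = Q.cdist x y ∧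
  Q.cdist y w + Q.cdist w z = Q.cdist y z ∧
  Q.cdist x w + Q.cdist w z = Q.cdist x z

end CubeComplex

/-! ### Coarse median spaces -/

variable {X : Type u} [MetricSpace X]

/-- `(X, m)` is a coarse median space of rank at most `r` with parameter function `h`. -/
structure IsCoarseMedian (m : X → X → X → X) (h : ℕ → ℕ) (r : ℕ) : Prop where
  lipschitz : ∀ x y z x' y' z' : X,
    dist (m x y z) (m x' y' z') ≤ h 1 * (dist x x' + dist y y' + dist z z') + h 0
  approx : ∀ (n : ℕ) (A : Finset X), A.Nonempty → A.card ≤ n →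
    ∃ (V : Type u) (_ : Finite V) (Q : CubeComplex V), Q.IsCAT0 ∧ Q.DimLE r ∧
      ∃ (f : V → X) (g : A → V),
        (∀ a b c w : V, Q.IsMedian a b c w → dist (f w) (m (f a) (f b) (f c)) ≤ h n) ∧
        (∀ a : A, dist (a : X) (f (g a)) ≤ h n)

/-- The median interval `[x, y]`. -/
def interval (m : X → X → X → X) (x y : X) : Set X := Set.range (m x y)

/-- The median join `J(A)`. -/
def join (m : X → X → X → X) (A : Set X) : Set X := ⋃ x ∈ A, ⋃ y ∈ A, interval m x y

/-- The median hull `J^r(A)` in a coarse median space of rank `r`. -/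
def hull (m : X → X → X → X) (r : ℕ) (A : Set X) : Set X := (join m)^[r] A

/-- `H ⊆ X` admits a `(v, K)`-cubical approximation: a `K`-median `(K, K)`-quasi-isometry to `H` from
(the vertices, with the combinatorial metric, of) a CAT(0) cube complex of dimension at most `v`. -/
def AdmitsCubicalApprox (m : X → X → X → X) (v : ℕ) (K : ℝ) (H : Set X) : Prop :=
  ∃ (V : Type u) (Q : CubeComplex V), Q.IsCAT0 ∧ Q.DimLE v ∧
    ∃ f : V → X,
      (∀ a, f a ∈ H) ∧
      (∀ a b c w, Q.IsMedian a b c w → dist (f w) (m (f a) (f b) (f c)) < K) ∧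
      (∀ a b, K⁻¹ * Q.cdist a b - K ≤ dist (f a) (f b) ∧
        dist (f a) (f b) ≤ K * Q.cdist a b + K) ∧
      (∀ x ∈ H, ∃ a, dist (f a) x ≤ K)

/-- `(X, m)` is a locally quasi-cubical space of dimension (at most) `v`, with parameters
`h, r` as a coarse median space and approximation constants `k`. -/
structure IsLQC (m : X → X → X → X) (h : ℕ → ℕ) (r v : ℕ) (k : ℕ → ℝ) : Prop where
  coarseMedian : IsCoarseMedian m h r
  approx : ∀ F : Finset X, F.Nonempty → AdmitsCubicalApprox m v (k F.card) (hull m r F)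

/-- The median on the half-line: the middle one of three numbers. -/
noncomputable def middle (a b c : ℝ≥0) : ℝ≥0 := max (min a b) (min (max a b) c)

/-- `γ` is a `L`-median ray. -/
structure IsMedianRay (m : X → X → X → X) (L : ℝ) (γ : ℝ≥0 → X) : Prop where
  qie : ∀ s t, L⁻¹ * dist s t - L ≤ dist (γ s) (γ t) ∧ dist (γ s) (γ t) ≤ L * dist s t + L
  median : ∀ a b c, dist (γ (middle a b c)) (m (γ a) (γ b) (γ c)) < L

end LQC

namespace LQC

/-! ### Cubes, squares and flips -/

/-! Truncate every ray at time `N`, and let `F_N` consist of the given points and the two ends of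
each truncated ray. Since `F_N` has at most `p + 2n` points, its hull has a cubical approximation
whose constant does not depend on `N`. It remains to see that the hulls of the `F_N` coarsely
exhaust the required hull, and that uniform approximations of an exhaustion have a limit.

Exhaustion (`IsCoarseMedian.exists_near_hull`): a point of a truncated ray is within `L` of its
median with the two ends, so it lies coarsely in `J(F_N)`, and a point of the big hull lies coarsely
in `J^{r+1}(F_N)` for large `N`. Boundedly many points are involved, so the computation transfers to
a finite CAT(0) cube complex of dimension at most `r`. There the `r`-th join is already stable
(`IsCAT0.vertexJoin_iterate_subset`), and mapping back lands near the hull of `F_N`.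

Limit (`admitsCubicalApprox_of_exhaustion`): the approximating complexes, based near a common point,
have an ultralimit, and properness of `X` makes the maps converge along the ultrafilter.
Null-homotopies might have unbounded length, so simple connectivity is traded for a condition on
distances, `IsModular`, which does pass to ultralimits. `IsCAT0.isModular` obtains it from a normal
form for edge paths, in the style of a word problem; `IsModular.simplyConnected` goes back. The same
condition gives medians and convex halfspaces, on which the stability of joins rests. -/

theorem IsFaceMap.injective {k n : ℕ} {φ : (Fin k → Bool) → (Fin n → Bool)} (h : IsFaceMap φ) :
    Function.Injective φ := by
  intro a b hab
  have := h a b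
  rw [hab, hammingDist_self] at this
  exact hammingDist_eq_zero.1 this.symm

/-- The vertex of the cube obtained from `α` by changing the `i`-th coordinate. -/
def flip {n : ℕ} (i : Fin n) (α : Fin n → Bool) : Fin n → Bool := Function.update α i (!α i)

theorem flip_same {n : ℕ} (i : Fin n) (α : Fin n → Bool) : flip i α i = !α i := by simp [flip]

theorem flip_of_ne {n : ℕ} {i j : Fin n} (h : j ≠ i) (α : Fin n → Bool) : flip i α j = α j := by
  simp [flip, h]

theorem flip_comm {n : ℕ} (i j : Fin n) (α : Fin n → Bool) :
    flip i (flip j α) = flip j (flip i α) := by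
  ext l
  by_cases h : l = i <;> by_cases h' : l = j
  · subst h; subst h'; rfl
  · subst h; simp [flip, h']
  · subst h'; simp [flip, h]
  · simp [flip, h, h']

theorem exists_eq_flip_of_hammingDist_eq_one {n : ℕ} {α β : Fin n → Bool}
    (h : hammingDist α β = 1) : ∃ i, β = flip i α := by
  obtain ⟨i, hi⟩ := Finset.card_eq_one.1 h
  refine ⟨i, ?_⟩
  ext l
  have hl := Finset.ext_iff.1 hi l
  simp only [Finset.mem_filter, Finset.mem_univ, true_and, Finset.mem_singleton] at hl
  by_cases h : l = i
  · subst h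
    have := hl.2 rfl
    rw [flip_same]
    cases h1 : α l <;> cases h2 : β l <;> simp_all
  · rw [flip_of_ne h]
    by_contra hne
    exact h (hl.1 (Ne.symm hne))

/-- The inclusion of the face through `α` spanned by two coordinates. -/
def squareFace {n : ℕ} (i j : Fin n) (α : Fin n → Bool) (e : Fin 2 → Bool) : Fin n → Bool :=
  fun l => if l = i then xor (α l) (e 0) else if l = j then xor (α l) (e 1) else α l

theorem isFaceMap_squareFace {n : ℕ} {i j : Fin n} (hij : i ≠ j) (α : Fin n → Bool) :
    IsFaceMap (squareFace i j α) := by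
  intro a b
  have hinj : Function.Injective ![i, j] := by
    intro s t hst
    fin_cases s <;> fin_cases t <;> simp_all [Ne.symm hij]
  have : (Finset.univ.filter fun l => squareFace i j α a l ≠ squareFace i j α b l)
      = (Finset.univ.filter fun s => a s ≠ b s).image ![i, j] := by
    ext l
    simp only [Finset.mem_filter, Finset.mem_univ, true_and, Finset.mem_image,
      Fin.exists_fin_two, Matrix.cons_val_zero, Matrix.cons_val_one]
    by_cases h : l = i
    · subst h; simp [squareFace, Ne.symm hij]
    · by_cases h' : l = j
      · subst h'; simp [squareFace, h, hij]
      · simp [squareFace, h, h', Ne.symm h, Ne.symm h']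
  rw [hammingDist, this, Finset.card_image_of_injective _ hinj]
  rfl

/-- The inclusion of the edge at `α` in the direction of one coordinate. -/
def edgeFace {n : ℕ} (i : Fin n) (α : Fin n → Bool) (e : Fin 1 → Bool) : Fin n → Bool :=
  fun l => if l = i then xor (α l) (e 0) else α l

theorem isFaceMap_edgeFace {n : ℕ} (i : Fin n) (α : Fin n → Bool) :
    IsFaceMap (edgeFace i α) := by
  intro a b
  have : (Finset.univ.filter fun l => edgeFace i α a l ≠ edgeFace i α b l)
      = (Finset.univ.filter fun s => a s ≠ b s).image fun _ => i := by
    ext l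
    simp only [Finset.mem_filter, Finset.mem_univ, true_and, Finset.mem_image,
      Fin.exists_fin_one]
    by_cases h : l = i
    · subst h; simp [edgeFace]
    · simp [edgeFace, h, Ne.symm h]
  rw [hammingDist, this, Finset.card_image_of_injective _ fun s t _ => Subsingleton.elim s t]
  rfl

namespace CubeComplex

variable {V : Type u} {Q : CubeComplex V}

theorem IsCube.adj_flip {n : ℕ} {c : (Fin n → Bool) → V} (hc : Q.IsCube n c) (i : Fin n)
    (α : Fin n → Bool) : Q.skeleton.Adj (c α) (c (flip i α)) := by
  refine ⟨_, Q.face hc (isFaceMap_edgeFace i α), ?_, ?_⟩ <;> simp only [Function.comp_apply] <;>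
    congr 1 <;> ext l <;> by_cases h : l = i <;> simp [edgeFace, flip, h]

theorem IsCube.isSquare_flip {n : ℕ} {c : (Fin n → Bool) → V} (hc : Q.IsCube n c) {i j : Fin n}
    (hij : i ≠ j) (α : Fin n → Bool) :
    Q.IsSquare (c α) (c (flip i α)) (c (flip j (flip i α))) (c (flip j α)) := by
  refine ⟨_, Q.face hc (isFaceMap_squareFace hij α), ?_, ?_, ?_, ?_⟩ <;>
    simp only [Function.comp_apply] <;> congr 1 <;> ext l <;> by_cases h : l = i <;>
    by_cases h' : l = j <;> simp_all [squareFace, flip]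

/-- The edge meets the cube in a common face. That face contains both ends of the edge, and face
maps preserve Hamming distance. -/
theorem IsCube.hammingDist_eq_one {n : ℕ} {c : (Fin n → Bool) → V} (hc : Q.IsCube n c)
    {α β : Fin n → Bool} (h : Q.skeleton.Adj (c α) (c β)) : hammingDist α β = 1 := by
  obtain ⟨e, he, h0, h1⟩ := h
  obtain ⟨k, φ, φ', hφ, hφ', heq, hr⟩ := Q.inter hc he ⟨c α, ⟨α, rfl⟩, ⟨_, h0⟩⟩
  have hα : c α ∈ Set.range (c ∘ φ) := hr ▸ ⟨⟨α, rfl⟩, ⟨_, h0⟩⟩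
  have hβ : c β ∈ Set.range (c ∘ φ) := hr ▸ ⟨⟨β, rfl⟩, ⟨_, h1⟩⟩
  obtain ⟨κ, hκ⟩ := hα
  obtain ⟨κ', hκ'⟩ := hβ
  have e1 : φ' κ = ![false] := Q.injective he (by
    rw [h0, ← hκ]; exact (congrFun heq κ).symm)
  have e2 : φ' κ' = ![true] := Q.injective he (by
    rw [h1, ← hκ']; exact (congrFun heq κ').symm)
  rw [← Q.injective hc hκ, ← Q.injective hc hκ', hφ, ← hφ' κ κ', e1, e2]
  decide

theorem IsCube.exists_eq_flip {n : ℕ} {c : (Fin n → Bool) → V} (hc : Q.IsCube n c)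
    {α : Fin n → Bool} {y : V} (h : Q.skeleton.Adj (c α) y) (hy : y ∈ Set.range c) :
    ∃ i, y = c (flip i α) := by
  obtain ⟨β, rfl⟩ := hy
  obtain ⟨i, hi⟩ := exists_eq_flip_of_hammingDist_eq_one (hc.hammingDist_eq_one h)
  exact ⟨i, by rw [hi]⟩

theorem IsCube.exists_walk_length_le {n : ℕ} {c : (Fin n → Bool) → V} (hc : Q.IsCube n c)
    (α β : Fin n → Bool) : ∃ p : Q.skeleton.Walk (c α) (c β), p.length ≤ n := by
  have key : ∀ (d : ℕ) (α : Fin n → Bool), hammingDist α β = d →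
      ∃ p : Q.skeleton.Walk (c α) (c β), p.length = d := by
    intro d
    induction d with
    | zero =>
      intro α h
      obtain rfl := hammingDist_eq_zero.1 h
      exact ⟨.nil, rfl⟩
    | succ d ih =>
      intro α h
      have hpos : 0 < hammingDist α β := by omega
      obtain ⟨i, hi⟩ := Finset.card_pos.1 hpos
      simp only [Finset.mem_filter, Finset.mem_univ, true_and] at hi
      have h2 : hammingDist (flip i α) β = d := by
        have : (Finset.univ.filter fun l => flip i α l ≠ β l)
            = (Finset.univ.filter fun l => α l ≠ β l).erase i := by
          ext l
          by_cases hl : l = i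
          · subst hl
            simp only [flip_same, Finset.mem_filter, Finset.mem_univ, true_and, Finset.mem_erase]
            cases h1 : α l <;> cases h2 : β l <;> simp_all
          · simp [hl, flip_of_ne hl]
        rw [hammingDist, this, Finset.card_erase_of_mem (by simpa using hi)]
        change hammingDist α β - 1 = d
        omega
      obtain ⟨p, hp⟩ := ih _ h2
      exact ⟨.cons (hc.adj_flip i α) p, by simp [hp]⟩
  obtain ⟨p, hp⟩ := key _ α rfl
  exact ⟨p, by simpa [hp] using hammingDist_le_card_fintype (x := α) (y := β)⟩

/-! ### Symmetries and uniqueness of squares -/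

theorem IsSquare.rotate {x y z w : V} (h : Q.IsSquare x y z w) : Q.IsSquare y z w x := by
  obtain ⟨c, hc, rfl, rfl, rfl, rfl⟩ := h
  refine ⟨c ∘ fun a => ![!(a 1), a 0], Q.face hc ?_, ?_, ?_, ?_, ?_⟩
  · intro a b
    simp only [hammingDist, Finset.card_filter, Fin.sum_univ_two]
    rw [add_comm]
    by_cases h : a 1 = b 1 <;> simp [h]
  all_goals simp

theorem IsSquare.reflect {x y z w : V} (h : Q.IsSquare x y z w) : Q.IsSquare x w z y := by
  obtain ⟨c, hc, rfl, rfl, rfl, rfl⟩ := h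
  refine ⟨c ∘ fun a => ![a 1, a 0], Q.face hc ?_, ?_, ?_, ?_, ?_⟩
  · intro a b
    simp only [hammingDist, Finset.card_filter, Fin.sum_univ_two]
    rw [add_comm]
    by_cases h : a 1 = b 1 <;> simp [h]
  all_goals simp

theorem IsSquare.adj {x y z w : V} (h : Q.IsSquare x y z w) : Q.skeleton.Adj x y := by
  obtain ⟨c, hc, rfl, rfl, rfl, rfl⟩ := h
  have := hc.adj_flip 0 ![false, false]
  convert this using 2
  ext l; fin_cases l <;> simp [flip]

theorem IsSquare.adj₂ {x y z w : V} (h : Q.IsSquare x y z w) : Q.skeleton.Adj y z := h.rotate.adj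

theorem IsSquare.adj₃ {x y z w : V} (h : Q.IsSquare x y z w) : Q.skeleton.Adj w z :=
  h.reflect.adj₂

theorem IsSquare.adj₄ {x y z w : V} (h : Q.IsSquare x y z w) : Q.skeleton.Adj x w :=
  h.reflect.adj

theorem IsSquare.ne {x y z w : V} (h : Q.IsSquare x y z w) : x ≠ z := by
  obtain ⟨c, hc, rfl, rfl, rfl, rfl⟩ := h
  intro h
  have := congrFun (Q.injective hc h) 0
  simp at this

/-- The two squares share three vertices, and a common face with more than two vertices must be the
whole square. -/
theorem IsSquare.unique {x y z z' w : V} (h : Q.IsSquare x y z w) (h' : Q.IsSquare x y z' w) :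
    z = z' := by
  have hyw : y ≠ w := h.rotate.ne
  have hxy : x ≠ y := h.adj.ne
  have hxw : x ≠ w := h.adj₄.ne
  have hxz := h.ne
  have hyz := h.adj₂.ne
  have hwz := h.adj₃.ne
  obtain ⟨c, hc, h0, h1, h2, h3⟩ := h
  obtain ⟨c', hc', h0', h1', hzc, h3'⟩ := h'
  obtain ⟨k, φ, φ', hφ, hφ', heq, hr⟩ := Q.inter hc hc' ⟨x, ⟨_, h0⟩, ⟨_, h0'⟩⟩
  have hsub : ({x, y, w} : Set V) ⊆ Set.range (c ∘ φ) := by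
    rw [← hr]
    rintro t (rfl | rfl | rfl)
    · exact ⟨⟨_, h0⟩, ⟨_, h0'⟩⟩
    · exact ⟨⟨_, h1⟩, ⟨_, h1'⟩⟩
    · exact ⟨⟨_, h3⟩, ⟨_, h3'⟩⟩
  have hk : 2 ≤ k := by
    have h3 : Set.ncard ({x, y, w} : Set V) = 3 := Set.ncard_eq_three.2 ⟨x, y, w, hxy, hxw, hyw, rfl⟩
    have h4 := Set.ncard_le_ncard hsub (Set.finite_range _)
    have h5 : Set.ncard (Set.range (c ∘ φ)) ≤ 2 ^ k := by
      rw [← Set.image_univ]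
      refine (Set.ncard_image_le Set.finite_univ).trans ?_
      simp [Set.ncard_univ]
    by_contra hk
    have : 2 ^ k ≤ 2 ^ 1 := Nat.pow_le_pow_right (by norm_num) (by omega)
    omega
  have hsurj : Function.Surjective φ := by
    have hcard : Fintype.card (Fin k → Bool) = Fintype.card (Fin 2 → Bool) := by
      apply le_antisymm (Fintype.card_le_of_injective φ hφ.injective)
      simp only [Fintype.card_fun, Fintype.card_fin, Fintype.card_bool]
      exact Nat.pow_le_pow_right (by norm_num) hk
    exact ((Fintype.bijective_iff_injective_and_card φ).2 ⟨hφ.injective, hcard⟩).2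
  obtain ⟨κ, hκ⟩ := hsurj ![true, true]
  have hz : z ∈ Set.range c' := by
    have : z ∈ Set.range c ∩ Set.range c' := by
      rw [hr]; exact ⟨κ, by simp [hκ, h2]⟩
    exact this.2
  obtain ⟨β, hβ⟩ := hz
  have hβ' : β = ![β 0, β 1] := by ext l; fin_cases l <;> rfl
  rw [hβ'] at hβ
  cases h5 : β 0 <;> cases h6 : β 1 <;> rw [h5, h6] at hβ
  · exact absurd (h0'.symm.trans hβ) hxz
  · exact absurd (h3'.symm.trans hβ) hwz
  · exact absurd (h1'.symm.trans hβ) hyz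
  · exact hβ.symm.trans hzc

/-- Three squares at a vertex which pairwise share an edge span a 3-cube. -/
theorem FlagLinks.exists_cube (hQ : Q.FlagLinks) {y x w w' a b t : V} (h₁ : Q.IsSquare y x a w)
    (h₂ : Q.IsSquare y x b w') (h₃ : Q.IsSquare y w t w') :
    ∃ u, Q.IsSquare x a u b ∧ Q.IsSquare a w t u ∧ Q.IsSquare b w' t u := by
  classical
  obtain ⟨n, c, hc, ⟨α, rfl⟩, hS⟩ := hQ y {x, w, w'} (by
      intro z hz
      simp only [Finset.mem_insert, Finset.mem_singleton] at hz
      rcases hz with rfl | rfl | rfl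
      exacts [h₁.adj, h₁.adj₄, h₂.adj₄]) (by
      intro z hz z' hz' hne
      simp only [Finset.mem_insert, Finset.mem_singleton] at hz hz'
      rcases hz with rfl | rfl | rfl <;> rcases hz' with rfl | rfl | rfl
      exacts [absurd rfl hne, ⟨_, h₁⟩, ⟨_, h₂⟩, ⟨_, h₁.reflect⟩, absurd rfl hne, ⟨_, h₃⟩,
        ⟨_, h₂.reflect⟩, ⟨_, h₃.reflect⟩, absurd rfl hne])
  obtain ⟨i, rfl⟩ := hc.exists_eq_flip h₁.adj (hS (by simp))
  obtain ⟨j, rfl⟩ := hc.exists_eq_flip h₁.adj₄ (hS (by simp))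
  obtain ⟨k, rfl⟩ := hc.exists_eq_flip h₂.adj₄ (hS (by simp))
  have hij : i ≠ j := fun h => h₁.rotate.ne (by rw [h])
  have hik : i ≠ k := fun h => h₂.rotate.ne (by rw [h])
  have hjk : j ≠ k := fun h => h₃.rotate.ne (by rw [h])
  obtain rfl := h₁.unique (hc.isSquare_flip hij α)
  obtain rfl := h₂.unique (hc.isSquare_flip hik α)
  obtain rfl := h₃.unique (hc.isSquare_flip hjk α)
  refine ⟨c (flip k (flip j (flip i α))), hc.isSquare_flip hjk _, ?_, ?_⟩
  · have := hc.isSquare_flip hik (flip j α)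
    rw [flip_comm i j α] at this
    exact this.reflect.rotate.rotate.rotate
  · have := hc.isSquare_flip hij (flip k α)
    rw [flip_comm i k α, flip_comm j k α, flip_comm j k] at this
    exact this.reflect.rotate.rotate.rotate

/-- The edges at a vertex which pairwise span squares are at most as many as the dimension. -/
theorem FlagLinks.card_le (hQ : Q.FlagLinks) {r : ℕ} (hr : Q.DimLE r) {x : V} {S : Finset V}
    (h₁ : ∀ y ∈ S, Q.skeleton.Adj x y)
    (h₂ : ∀ y ∈ S, ∀ z ∈ S, y ≠ z → ∃ w, Q.IsSquare x y w z) : S.card ≤ r := by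
  obtain ⟨n, c, hc, ⟨α, rfl⟩, hS⟩ := hQ x S h₁ h₂
  refine le_trans ?_ (hr n c hc)
  classical
  have h : S ⊆ Finset.univ.image fun i => c (flip i α) := by
    intro y hy
    obtain ⟨i, hi⟩ := hc.exists_eq_flip (h₁ y hy) (hS hy)
    exact Finset.mem_image.2 ⟨i, Finset.mem_univ _, hi.symm⟩
  simpa using (Finset.card_le_card h).trans Finset.card_image_le

end CubeComplex
end LQC

namespace LQC
namespace CubeComplex

variable {V : Type u} {Q : CubeComplex V}

/-! ### Shuffles of edge paths -/

/-- Homotopy of edge paths through pushes across 2-cubes only. -/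
inductive Shuffle (Q : CubeComplex V) :
    {x t : V} → Q.skeleton.Walk x t → Q.skeleton.Walk x t → Prop
  | refl {x t : V} (p : Q.skeleton.Walk x t) : Shuffle Q p p
  | symm {x t : V} {p q : Q.skeleton.Walk x t} : Shuffle Q p q → Shuffle Q q p
  | trans {x t : V} {p q r : Q.skeleton.Walk x t} : Shuffle Q p q → Shuffle Q q r → Shuffle Q p r
  | cons {x y t : V} (e : Q.skeleton.Adj x y) {p q : Q.skeleton.Walk y t} :
      Shuffle Q p q → Shuffle Q (.cons e p) (.cons e q)
  | square {x y z w t : V} (_ : Q.IsSquare x y z w)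
      (exy : Q.skeleton.Adj x y) (eyz : Q.skeleton.Adj y z)
      (exw : Q.skeleton.Adj x w) (ewz : Q.skeleton.Adj w z) (p : Q.skeleton.Walk z t) :
      Shuffle Q (.cons exy (.cons eyz p)) (.cons exw (.cons ewz p))

theorem Shuffle.length_eq {x t : V} {p q : Q.skeleton.Walk x t} (h : Q.Shuffle p q) :
    p.length = q.length := by
  induction h with
  | refl => rfl
  | symm _ ih => exact ih.symm
  | trans _ _ ih ih' => exact ih.trans ih'
  | cons _ _ ih => simp [ih]
  | square => simp

/-- Two edge paths agree up to shuffles of their tails, or their first edges span a square which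
both can be shuffled across. -/
inductive Diamond (Q : CubeComplex V) :
    {x t : V} → Q.skeleton.Walk x t → Q.skeleton.Walk x t → Prop
  | nil {t : V} : Diamond Q (.nil : Q.skeleton.Walk t t) .nil
  | same {x y t : V} (e : Q.skeleton.Adj x y) {p q : Q.skeleton.Walk y t} :
      Q.Shuffle p q → Diamond Q (.cons e p) (.cons e q)
  | square {x y z w t : V} (_ : Q.IsSquare x y z w)
      (exy : Q.skeleton.Adj x y) (eyz : Q.skeleton.Adj y z)
      (exw : Q.skeleton.Adj x w) (ewz : Q.skeleton.Adj w z) (s : Q.skeleton.Walk z t)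
      {p : Q.skeleton.Walk y t} {q : Q.skeleton.Walk w t} :
      Q.Shuffle p (.cons eyz s) → Q.Shuffle q (.cons ewz s) → Diamond Q (.cons exy p) (.cons exw q)

theorem Diamond.refl {x t : V} (p : Q.skeleton.Walk x t) : Q.Diamond p p := by
  cases p with
  | nil => exact .nil
  | cons e p => exact .same e (.refl p)

theorem Diamond.symm {x t : V} {p q : Q.skeleton.Walk x t} (h : Q.Diamond p q) :
    Q.Diamond q p := by
  cases h with
  | nil => exact .nil
  | same e h => exact .same e h.symm
  | square hs exy eyz exw ewz s hp hq => exact .square hs.reflect exw ewz exy eyz s hq hp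

/-- This is where flagness enters. When both relations are squares, the tail of `q` shuffles to two
paths, which `ih` compares because they are shorter. -/
theorem Diamond.trans (hQ : Q.FlagLinks) {n : ℕ}
    (ih : ∀ {x t : V} {p q : Q.skeleton.Walk x t}, p.length < n → Q.Shuffle p q → Q.Diamond p q)
    {x t : V} {p q r : Q.skeleton.Walk x t} (hn : q.length ≤ n) (h₁ : Q.Diamond p q)
    (h₂ : Q.Diamond q r) : Q.Diamond p r := by
  cases h₁ with
  | nil => exact h₂
  | same e h =>
    cases h₂
    · rename_i h'
      exact .same e (h.trans h')
    · rename_i z w exw ewz s q hq hs exy eyz hp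
      exact .square hs exy eyz exw ewz s (h.trans hp) hq
  | square hs exy eyz exw ewz s hp hq =>
    rename_i y₀ w y₁ p q
    cases h₂
    · rename_i h'
      exact .square hs exy eyz exw ewz s hp (h'.symm.trans hq)
    · rename_i w' y₂ exw' ewz' s' q' hq' hs' exy' eyz' hp'
      have hlen := hq.length_eq
      simp only [SimpleGraph.Walk.length_cons] at hn hlen
      have hd : Q.Diamond (.cons ewz s) (.cons eyz' s') :=
        ih (by simp only [SimpleGraph.Walk.length_cons]; omega) (hq.symm.trans hp')
      cases hd with
      | same _ h =>
        -- Both squares now have three vertices in common, so their fourth vertices agree.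
        obtain rfl : y₀ = y₂ := hs.rotate.rotate.rotate.unique hs'.rotate.reflect
        exact .same _ (hp.trans ((h.cons eyz).trans hq'.symm))
      | square hs'' e₁ e₂ e₃ e₄ s'' hs₁ hs₂ =>
        -- Three squares meet at the end of the first edge of `q`. The 3-cube they span has a face
        -- at `x` containing the first edges of `p` and `r`.
        obtain ⟨u, hu₁, hu₂, hu₃⟩ := hQ.exists_cube (a := y₀) (b := y₂)
          hs.rotate.rotate.rotate hs'.rotate.reflect hs''
        refine .square hu₁ exy hu₁.adj₂ exw' hu₁.adj₃ (.cons hu₂.adj₃ s'') ?_ ?_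
        · exact hp.trans ((hs₁.cons eyz).trans (.square hu₂ _ _ _ _ _))
        · exact hq'.trans ((hs₂.cons ewz').trans (.square hu₃ _ _ _ _ _))

/-- Outer induction on length, inner induction on the shuffle; only transitivity needs the outer
hypothesis. -/
theorem Shuffle.diamond (hQ : Q.FlagLinks) {x t : V} {p q : Q.skeleton.Walk x t}
    (h : Q.Shuffle p q) : Q.Diamond p q := by
  have key : ∀ (n : ℕ) {x t : V} {p q : Q.skeleton.Walk x t}, p.length < n → Q.Shuffle p q →
      Q.Diamond p q := by
    intro n
    induction n with
    | zero => intro _ _ _ _ h; omega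
    | succ n ih =>
      intro x t p q hn h
      induction h with
      | refl p => exact .refl p
      | symm h hi => exact (hi (by rw [h.length_eq]; exact hn)).symm
      | trans h h' hi hi' =>
        have := h.length_eq
        exact Diamond.trans hQ (n := n) ih (by omega) (hi hn) (hi' (by omega))
      | cons e h _ => exact .same e h
      | square hs exy eyz exw ewz p => exact .square hs exy eyz exw ewz p (.refl _) (.refl _)
  exact key _ (Nat.lt_succ_self _) h

theorem Shuffle.cancel (hQ : Q.FlagLinks) {x y t : V} {e e' : Q.skeleton.Adj x y}
    {p q : Q.skeleton.Walk y t} (h : Q.Shuffle (.cons e p) (.cons e' q)) : Q.Shuffle p q := by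
  cases h.diamond hQ with
  | same _ h => exact h
  | square hs => exact absurd rfl hs.rotate.ne

theorem Shuffle.exists_of_ne (hQ : Q.FlagLinks) {x y w t : V} {e : Q.skeleton.Adj x y}
    {e' : Q.skeleton.Adj x w} {p : Q.skeleton.Walk y t} {q : Q.skeleton.Walk w t} (hne : y ≠ w)
    (h : Q.Shuffle (.cons e p) (.cons e' q)) :
    ∃ (z : V) (hs : Q.IsSquare x y z w) (s : Q.skeleton.Walk z t),
      Q.Shuffle p (.cons hs.adj₂ s) ∧ Q.Shuffle q (.cons hs.adj₃ s) := by
  cases h.diamond hQ with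
  | same _ h => exact absurd rfl hne
  | square hs _ _ _ _ s hp hq => exact ⟨_, hs, s, hp, hq⟩

theorem Shuffle.exists_of_square (hQ : Q.FlagLinks) {x y z w t : V} (hs : Q.IsSquare x y z w)
    {e : Q.skeleton.Adj x y} {e' : Q.skeleton.Adj x w} {p : Q.skeleton.Walk y t}
    {q : Q.skeleton.Walk w t} (h : Q.Shuffle (.cons e p) (.cons e' q)) :
    ∃ s : Q.skeleton.Walk z t,
      Q.Shuffle p (.cons hs.adj₂ s) ∧ Q.Shuffle q (.cons hs.adj₃ s) := by
  obtain ⟨z', hs', s, h₁, h₂⟩ := h.exists_of_ne hQ hs.rotate.ne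
  obtain rfl := hs'.unique hs
  exact ⟨s, h₁, h₂⟩

/-! ### Reduced edge paths -/

/-- An edge path none of whose shuffles has a backtrack. -/
def Reduced (Q : CubeComplex V) : {x t : V} → Q.skeleton.Walk x t → Prop
  | _, _, .nil => True
  | _, _, .cons e p => Reduced Q p ∧ ∀ p', ¬ Q.Shuffle p (.cons e.symm p')

theorem Reduced.of_square (hQ : Q.FlagLinks) {x y z w t : V} (hs : Q.IsSquare x y z w)
    {exy : Q.skeleton.Adj x y} {eyz : Q.skeleton.Adj y z}
    {exw : Q.skeleton.Adj x w} {ewz : Q.skeleton.Adj w z} {p : Q.skeleton.Walk z t}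
    (h : Q.Reduced (.cons exy (.cons eyz p))) : Q.Reduced (.cons exw (.cons ewz p)) := by
  obtain ⟨⟨hp, h₁⟩, h₂⟩ := h
  refine ⟨⟨hp, fun p' h => ?_⟩, fun p' h => ?_⟩
  · exact h₂ (.cons exw p') ((h.cons eyz).trans (.square hs.rotate _ _ _ _ _))
  · obtain ⟨s, hs₁, _⟩ := h.exists_of_square hQ hs.reflect.rotate
    exact h₁ s hs₁

theorem Shuffle.reduced_iff (hQ : Q.FlagLinks) {x t : V} {p q : Q.skeleton.Walk x t}
    (h : Q.Shuffle p q) : Q.Reduced p ↔ Q.Reduced q := by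
  induction h with
  | refl => rfl
  | symm _ ih => exact ih.symm
  | trans _ _ ih ih' => exact ih.trans ih'
  | cons e h ih =>
    exact and_congr ih (forall_congr' fun p' => not_congr ⟨h.symm.trans, h.trans⟩)
  | square hs => exact ⟨.of_square hQ hs, .of_square hQ hs.reflect⟩

theorem not_reduced_backtrack {x y t : V} {e : Q.skeleton.Adj x y} {e' : Q.skeleton.Adj y x}
    {p : Q.skeleton.Walk x t} : ¬ Q.Reduced (.cons e (.cons e' p)) :=
  fun h => h.2 p (.refl _)

/-- Up to shuffles, `q` is the reduction of the edge path `e p`. -/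
def Extends (Q : CubeComplex V) {x y t : V} (e : Q.skeleton.Adj x y) (p : Q.skeleton.Walk y t)
    (q : Q.skeleton.Walk x t) : Prop :=
  Q.Shuffle q (.cons e p) ∨ Q.Shuffle p (.cons e.symm q)

theorem Extends.symm {x y t : V} {e : Q.skeleton.Adj x y} {p : Q.skeleton.Walk y t}
    {q : Q.skeleton.Walk x t} (h : Q.Extends e p q) : Q.Extends e.symm q p := Or.symm h

theorem Extends.of_shuffle {x y t : V} {e : Q.skeleton.Adj x y} {p p' : Q.skeleton.Walk y t}
    {q : Q.skeleton.Walk x t} (h : Q.Extends e p q) (hp : Q.Shuffle p p') : Q.Extends e p' q :=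
  h.imp (fun h => h.trans (hp.cons e)) (fun h => hp.symm.trans h)

theorem Extends.unique (hQ : Q.FlagLinks) {x y t : V} {e : Q.skeleton.Adj x y}
    {p : Q.skeleton.Walk y t} {q q' : Q.skeleton.Walk x t} (hq : Q.Reduced q) (hq' : Q.Reduced q')
    (h : Q.Extends e p q) (h' : Q.Extends e p q') : Q.Shuffle q q' := by
  rcases h with h | h <;> rcases h' with h' | h'
  · exact h.trans h'.symm
  · exact absurd (((h.trans (h'.cons e)).reduced_iff hQ).1 hq) not_reduced_backtrack
  · exact absurd (((h'.trans (h.cons e)).reduced_iff hQ).1 hq') not_reduced_backtrack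
  · exact (h.symm.trans h').cancel hQ

theorem exists_extends (hQ : Q.FlagLinks) {x y t : V} (e : Q.skeleton.Adj x y)
    (p : Q.skeleton.Walk y t) (hp : Q.Reduced p) : ∃ q, Q.Reduced q ∧ Q.Extends e p q := by
  by_cases h : ∃ q, Q.Shuffle p (.cons e.symm q)
  · obtain ⟨q, h⟩ := h
    exact ⟨q, ((h.reduced_iff hQ).1 hp).1, .inr h⟩
  · exact ⟨.cons e p, ⟨hp, fun q hq => h ⟨q, hq⟩⟩, .inl (.refl _)⟩

/-- Prepending the two sides of a square gives the same reduction either way round. Of the eight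
combinations of lengthening and cancelling, four would put a backtrack into a shuffle of a reduced
path. -/
theorem Extends.square (hQ : Q.FlagLinks) {x y z w t : V} (hs : Q.IsSquare x y z w)
    {exy : Q.skeleton.Adj x y} {eyz : Q.skeleton.Adj y z}
    {exw : Q.skeleton.Adj x w} {ewz : Q.skeleton.Adj w z} {p : Q.skeleton.Walk z t}
    {a : Q.skeleton.Walk y t} {b : Q.skeleton.Walk x t} {a' : Q.skeleton.Walk w t}
    (hb : Q.Reduced b) (ha' : Q.Reduced a')
    (h₁ : Q.Extends eyz p a) (h₂ : Q.Extends exy a b) (h₃ : Q.Extends ewz p a') :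
    Q.Extends exw a' b := by
  rcases h₁ with h₁ | h₁ <;> rcases h₂ with h₂ | h₂ <;> rcases h₃ with h₃ | h₃
  · exact .inl ((h₂.trans (h₁.cons _)).trans ((Shuffle.square hs _ _ _ ewz _).trans
      (h₃.symm.cons _)))
  · refine absurd (((h₂.trans ((h₁.trans (h₃.cons _)).cons _)).trans
      ((Shuffle.square hs.rotate eyz ewz.symm exy.symm exw a').cons exy)).reduced_iff hQ |>.1 hb) ?_
    exact not_reduced_backtrack
  · obtain ⟨s, hs₁, _⟩ := (h₁.symm.trans h₂).exists_of_square hQ hs.rotate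
    exact absurd (((h₃.trans (hs₁.cons _)).reduced_iff hQ).1 ha') not_reduced_backtrack
  · obtain ⟨s, hs₁, hs₂⟩ := (h₁.symm.trans h₂).exists_of_square hQ hs.rotate
    have := (hs₁.symm.trans h₃).cancel hQ
    exact .inl (hs₂.trans (this.cons _))
  · exact .inr (((h₃.trans (h₁.cons _)).trans
      (.square hs.reflect.rotate _ _ exw.symm exy _)).trans (h₂.symm.cons _))
  · obtain ⟨s, hs₁, _⟩ := (h₁.symm.trans h₃).exists_of_square hQ hs.rotate.rotate.reflect
    exact absurd (((h₂.trans (hs₁.cons _)).reduced_iff hQ).1 hb) not_reduced_backtrack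
  · refine absurd ((((h₃.trans ((h₁.trans (h₂.cons _)).cons _))).trans
      ((Shuffle.square hs.rotate.rotate.reflect eyz.symm exy.symm ewz.symm exw.symm b).cons ewz)
      ).reduced_iff hQ |>.1 ha') ?_
    exact not_reduced_backtrack
  · obtain ⟨s, hs₁, hs₂⟩ := (h₁.symm.trans h₃).exists_of_square hQ hs.rotate.rotate.reflect
    have := (hs₁.symm.trans h₂).cancel hQ
    exact .inr (hs₂.trans (this.cons _))

/-- A reduced edge path homotopic to a given one. -/
noncomputable def normalForm (hQ : Q.FlagLinks) :
    {x t : V} → Q.skeleton.Walk x t → {p : Q.skeleton.Walk x t // Q.Reduced p}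
  | _, _, .nil => ⟨.nil, trivial⟩
  | _, _, .cons e p =>
    ⟨_, (exists_extends hQ e _ (normalForm hQ p).2).choose_spec.1⟩

theorem normalForm_cons (hQ : Q.FlagLinks) {x y t : V} (e : Q.skeleton.Adj x y)
    (p : Q.skeleton.Walk y t) :
    Q.Extends e (normalForm hQ p).1 (normalForm hQ (.cons e p)).1 :=
  (exists_extends hQ e _ (normalForm hQ p).2).choose_spec.2

/-- Edges act by prepending on shuffle classes of reduced paths. The action respects backtracks and
squares, hence homotopy. -/
theorem PathHomotopic.normalForm (hQ : Q.FlagLinks) {x t : V} {p q : Q.skeleton.Walk x t}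
    (h : Q.PathHomotopic p q) : Q.Shuffle (normalForm hQ p).1 (normalForm hQ q).1 := by
  induction h with
  | refl => exact .refl _
  | symm _ ih => exact ih.symm
  | trans _ _ ih ih' => exact ih.trans ih'
  | cons e _ ih =>
    exact Extends.unique hQ (Subtype.property _) (Subtype.property _)
      ((normalForm_cons hQ e _).of_shuffle ih) (normalForm_cons hQ e _)
  | backtrack e p =>
    exact Extends.unique hQ (Subtype.property _) (Subtype.property _)
      (normalForm_cons hQ e _) (normalForm_cons hQ e.symm p).symm
  | square hs exy eyz exw ewz p =>
    exact Extends.unique hQ (Subtype.property _) (Subtype.property _)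
      (Extends.square hQ hs (Subtype.property _) (Subtype.property _) (normalForm_cons hQ eyz p)
        (normalForm_cons hQ exy _) (normalForm_cons hQ ewz p)) (normalForm_cons hQ exw _)

theorem Reduced.shuffle_normalForm (hQ : Q.FlagLinks) {x t : V} {p : Q.skeleton.Walk x t}
    (hp : Q.Reduced p) : Q.Shuffle (normalForm hQ p).1 p := by
  induction p with
  | nil => exact .refl _
  | cons e p ih =>
    exact Extends.unique hQ (Subtype.property _) hp
      ((normalForm_cons hQ e p).of_shuffle (ih hp.1)) (.inl (.refl _))

/-- Prepending an edge is undone by prepending its inverse, so a common prefix can be stripped. -/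
theorem shuffle_normalForm_of_append (hQ : Q.FlagLinks) {x y t : V} (w : Q.skeleton.Walk y x)
    {p q : Q.skeleton.Walk x t}
    (h : Q.Shuffle (normalForm hQ (w.append p)).1 (normalForm hQ (w.append q)).1) :
    Q.Shuffle (normalForm hQ p).1 (normalForm hQ q).1 := by
  induction w with
  | nil => exact h
  | cons e w ih =>
    apply ih
    exact Extends.unique hQ (Subtype.property _) (Subtype.property _)
      ((normalForm_cons hQ e (w.append p)).symm.of_shuffle h)
      (normalForm_cons hQ e (w.append q)).symm

/-- In a CAT(0) cube complex a reduced edge path is determined by its endpoints, up to shuffles. -/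
theorem IsCAT0.shuffle_of_reduced (hQ : Q.IsCAT0) {x t : V} {p q : Q.skeleton.Walk x t}
    (hp : Q.Reduced p) (hq : Q.Reduced q) : Q.Shuffle p q := by
  have h : Q.Shuffle (normalForm hQ.2 p).1 (normalForm hQ.2 q).1 := by
    -- With this prefix both paths become closed, hence null-homotopic.
    apply shuffle_normalForm_of_append hQ.2 p.reverse
    exact ((hQ.1.2 t _).normalForm hQ.2).trans ((hQ.1.2 t _).normalForm hQ.2).symm
  exact ((hp.shuffle_normalForm hQ.2).symm.trans h).trans (hq.shuffle_normalForm hQ.2)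

theorem reduced_of_length_eq_dist {x t : V} {p : Q.skeleton.Walk x t}
    (hp : p.length = Q.skeleton.dist x t) : Q.Reduced p := by
  induction p with
  | nil => trivial
  | @cons x y t e p ih =>
    have h₁ := SimpleGraph.dist_le p
    obtain ⟨q, hq⟩ := p.reachable.exists_walk_length_eq_dist
    have h₂ := SimpleGraph.dist_le (SimpleGraph.Walk.cons e q)
    simp only [SimpleGraph.Walk.length_cons] at hp h₂
    refine ⟨ih (by omega), fun p' h => ?_⟩
    have h₃ := h.length_eq
    have h₄ := SimpleGraph.dist_le p'
    simp only [SimpleGraph.Walk.length_cons] at h₃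
    omega

/-! ### The quadrangle condition -/

/-- The 1-skeleton is connected and bipartite, and it satisfies the quadrangle condition, with the
quadrangles being 2-cubes. -/
structure IsModular (Q : CubeComplex V) : Prop where
  connected : Q.skeleton.Connected
  bipartite : ∀ {x y : V} (t : V), Q.skeleton.Adj x y →
    Q.skeleton.dist x t + 1 = Q.skeleton.dist y t ∨ Q.skeleton.dist y t + 1 = Q.skeleton.dist x t
  quadrangle : ∀ {x y w t : V}, Q.skeleton.Adj x y → Q.skeleton.Adj x w → y ≠ w →
    Q.skeleton.dist y t + 1 = Q.skeleton.dist x t → Q.skeleton.dist w t + 1 = Q.skeleton.dist x t →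
    ∃ z, Q.IsSquare x y z w ∧ Q.skeleton.dist z t + 2 = Q.skeleton.dist x t

/-- Geodesics are reduced, and reduced paths with the same ends are shuffles of each other.
Extending a geodesic by an edge changes its length by exactly one, which gives bipartiteness. Two
geodesics with different first edges are related by a diamond, which supplies the quadrangle. -/
theorem IsCAT0.isModular (hQ : Q.IsCAT0) : Q.IsModular where
  connected := hQ.1.1
  bipartite := by
    intro x y t e
    obtain ⟨p, hp⟩ := (hQ.1.1.preconnected x t).exists_walk_length_eq_dist
    obtain ⟨g, hg⟩ := (hQ.1.1.preconnected y t).exists_walk_length_eq_dist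
    obtain ⟨q, hq, h⟩ := exists_extends hQ.2 e.symm p (reduced_of_length_eq_dist hp)
    have h₁ := (hQ.shuffle_of_reduced (reduced_of_length_eq_dist hg) hq).length_eq
    rcases h with h | h <;> have h₂ := h.length_eq <;>
      simp only [SimpleGraph.Walk.length_cons] at h₂ <;> omega
  quadrangle := by
    intro x y w t e e' hne h h'
    obtain ⟨p, hp⟩ := (hQ.1.1.preconnected y t).exists_walk_length_eq_dist
    obtain ⟨q, hq⟩ := (hQ.1.1.preconnected w t).exists_walk_length_eq_dist
    have hsh : Q.Shuffle (.cons e p) (.cons e' q) := by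
      apply hQ.shuffle_of_reduced <;> apply reduced_of_length_eq_dist <;>
        simp only [SimpleGraph.Walk.length_cons] <;> omega
    obtain ⟨z, hs, s, h₁, _⟩ := hsh.exists_of_ne hQ.2 hne
    refine ⟨z, hs, ?_⟩
    have h₂ := h₁.length_eq
    have h₃ := SimpleGraph.dist_le s
    obtain ⟨g, hg⟩ := (hQ.1.1.preconnected z t).exists_walk_length_eq_dist
    have h₄ := SimpleGraph.dist_le (SimpleGraph.Walk.cons hs.adj₂ g)
    simp only [SimpleGraph.Walk.length_cons] at h₂ h₄
    omega

end CubeComplex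
end LQC

namespace LQC
namespace CubeComplex

variable {V : Type u} {Q : CubeComplex V}

/-! ### Simple connectivity from the quadrangle condition -/

theorem dist_le_of_adj (hQ : Q.skeleton.Connected) {x y : V} (e : Q.skeleton.Adj x y) (t : V) :
    Q.skeleton.dist x t ≤ Q.skeleton.dist y t + 1 := by
  have := hQ.dist_triangle (u := x) (v := y) (w := t)
  rw [SimpleGraph.dist_eq_one_iff_adj.2 e] at this
  omega

theorem exists_adj_of_dist_eq_succ {x t : V} {n : ℕ}
    (h : Q.skeleton.dist x t = n + 1) :
    ∃ y, Q.skeleton.Adj x y ∧ Q.skeleton.dist y t = n := by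
  have hr : Q.skeleton.Reachable x t := SimpleGraph.Reachable.of_dist_ne_zero (by omega)
  obtain ⟨p, hp⟩ := hr.exists_walk_length_eq_dist
  cases p with
  | nil => simp at h
  | @cons _ y _ e p =>
    refine ⟨y, e, ?_⟩
    have h₁ := SimpleGraph.dist_le p
    obtain ⟨q, hq⟩ := p.reachable.exists_walk_length_eq_dist
    have h₂ := SimpleGraph.dist_le (SimpleGraph.Walk.cons e q)
    simp only [SimpleGraph.Walk.length_cons] at hp h₂
    omega

theorem IsModular.homotopic_of_length_eq_dist (hQ : Q.IsModular) {t : V} (n : ℕ) :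
    ∀ {x : V} (p q : Q.skeleton.Walk x t), Q.skeleton.dist x t = n → p.length = n → q.length = n →
      Q.PathHomotopic p q := by
  induction n with
  | zero =>
    intro x p q _ hp hq
    cases p with
    | nil =>
      cases q with
      | nil => exact .refl _
      | cons e q => simp at hq
    | cons e p => simp at hp
  | succ n ih =>
    intro x p q hd hp hq
    cases p with
    | nil => simp at hp
    | @cons _ y _ e p =>
      cases q with
      | nil => simp at hq
      | @cons _ w _ e' q =>
        simp only [SimpleGraph.Walk.length_cons, add_left_inj] at hp hq
        have h₁ := SimpleGraph.dist_le p
        have h₂ := SimpleGraph.dist_le q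
        have h₃ := dist_le_of_adj hQ.connected e t
        have h₄ := dist_le_of_adj hQ.connected e' t
        have hy : Q.skeleton.dist y t = n := by omega
        have hw : Q.skeleton.dist w t = n := by omega
        by_cases hne : y = w
        · subst hne
          exact .cons e (ih p q hy hp hq)
        · obtain ⟨z, hs, hz⟩ := hQ.quadrangle e e' hne (t := t) (by omega) (by omega)
          obtain ⟨g, hg⟩ := (hQ.connected.preconnected z t).exists_walk_length_eq_dist
          have hp' := ih p (.cons hs.adj₂ g) hy hp
            (by simp only [SimpleGraph.Walk.length_cons]; omega)
          have hq' := ih q (.cons hs.adj₃ g) hw hq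
            (by simp only [SimpleGraph.Walk.length_cons]; omega)
          exact (PathHomotopic.cons e hp').trans
            ((PathHomotopic.square hs _ _ e' hs.adj₃ g).trans (PathHomotopic.cons e' hq'.symm))

/-- Contract from the far end: by bipartiteness each new edge either backtracks along a geodesic or
prolongs one. -/
theorem IsModular.homotopic_geodesic (hQ : Q.IsModular) {x t : V} (p : Q.skeleton.Walk x t) :
    ∀ g : Q.skeleton.Walk x t, g.length = Q.skeleton.dist x t → Q.PathHomotopic p g := by
  induction p with
  | nil => exact fun g hg => hQ.homotopic_of_length_eq_dist 0 _ g (by simp) rfl (by simpa using hg)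
  | @cons x y t e p ih =>
    intro g hg
    rcases hQ.bipartite t e with h | h
    · exact (PathHomotopic.cons e (ih (.cons e.symm g) (by
        simp only [SimpleGraph.Walk.length_cons]; omega))).trans (.backtrack e g)
    · obtain ⟨g', hg'⟩ := (hQ.connected.preconnected y t).exists_walk_length_eq_dist
      exact (PathHomotopic.cons e (ih g' hg')).trans
        (hQ.homotopic_of_length_eq_dist _ _ g h.symm
          (by simp only [SimpleGraph.Walk.length_cons]; omega) (by omega))

theorem IsModular.simplyConnected (hQ : Q.IsModular) : Q.SimplyConnected :=
  ⟨hQ.connected, fun _ p => hQ.homotopic_geodesic p .nil (by simp)⟩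

/-! ### Medians -/

/-- `w` lies on a combinatorial geodesic from `x` to `y`. -/
def Between (Q : CubeComplex V) (x w y : V) : Prop :=
  Q.skeleton.dist x w + Q.skeleton.dist w y = Q.skeleton.dist x y

theorem isMedian_iff {x y z w : V} :
    Q.IsMedian x y z w ↔ Q.Between x w y ∧ Q.Between y w z ∧ Q.Between x w z := by
  unfold IsMedian Between cdist
  norm_cast

/-- Move `y` towards `z`. Either `y` is itself the median, or some neighbour of `y` is closer to
both `x` and `z`, and a median for that neighbour is one for `y`. -/
theorem IsModular.exists_median (hQ : Q.IsModular) (x y z : V) : ∃ w, Q.IsMedian x y z w := by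
  have comm : ∀ a b, Q.skeleton.dist a b = Q.skeleton.dist b a := fun _ _ => SimpleGraph.dist_comm
  have tri : ∀ a b c, Q.skeleton.dist a c ≤ Q.skeleton.dist a b + Q.skeleton.dist b c :=
    fun _ _ _ => hQ.connected.dist_triangle
  simp only [isMedian_iff]
  unfold Between
  induction hn : Q.skeleton.dist y z generalizing y with
  | zero =>
    obtain rfl := (hQ.connected.dist_eq_zero_iff).1 hn
    exact ⟨y, by simp⟩
  | succ n ih =>
    have key : Q.skeleton.dist x y + Q.skeleton.dist y z = Q.skeleton.dist x z ∨
        ∃ y', Q.skeleton.Adj y y' ∧ Q.skeleton.dist y' z = n ∧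
          Q.skeleton.dist y' x + 1 = Q.skeleton.dist y x := by
      obtain ⟨y', e, hy'⟩ := exists_adj_of_dist_eq_succ hn
      rcases hQ.bipartite x e with h | h
      swap
      · exact .inr ⟨y', e, hy', h⟩
      obtain ⟨w, h₁, h₂, h₃⟩ := ih y' hy'
      rcases hk : Q.skeleton.dist y' w with _ | k
      · obtain rfl := (hQ.connected.dist_eq_zero_iff).1 hk
        left
        have := comm x y'
        have := comm x y
        have := tri x y z
        omega
      · obtain ⟨y'', e', hy''⟩ := exists_adj_of_dist_eq_succ hk
        have c₁ := comm w x
        have c₂ := comm w y'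
        have c₃ := comm x y'
        have t₁ := tri y'' w x
        have t₂ := tri y'' w z
        have a₁ := dist_le_of_adj hQ.connected e' x
        have a₂ := dist_le_of_adj hQ.connected e' z
        have hne : y ≠ y'' := by rintro rfl; omega
        -- The step to `y'` led away from `x`. The corner opposite `y'` repairs this: it is adjacent
        -- to `y` and closer to `x` and to `z`.
        obtain ⟨t, hs, ht⟩ := hQ.quadrangle e.symm e' hne (t := x) (by omega) (by omega)
        have a₃ := dist_le_of_adj hQ.connected hs.adj₃.symm z
        have a₄ := dist_le_of_adj hQ.connected hs.adj₂ z
        exact .inr ⟨t, hs.adj₂, by omega, by omega⟩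
    rcases key with h | ⟨y', e, hy', hx⟩
    · exact ⟨y, by simp, by simp [hn], h⟩
    · obtain ⟨w, h₁, h₂, h₃⟩ := ih y' hy'
      refine ⟨w, ?_, ?_, h₃⟩
      · have := tri x w y
        have := dist_le_of_adj hQ.connected e w
        have := comm y w
        have := comm y' w
        have := comm y x
        have := comm y' x
        omega
      · have := tri y w z
        have := dist_le_of_adj hQ.connected e w
        omega

/-- Halfspaces are convex. -/
theorem IsModular.halfspace_convex (hQ : Q.IsModular) {u x a b z : V} (e : Q.skeleton.Adj u x)
    (ha : Q.skeleton.dist u a + 1 = Q.skeleton.dist x a)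
    (hb : Q.skeleton.dist u b + 1 = Q.skeleton.dist x b) (h : Q.Between a z b) :
    Q.skeleton.dist u z + 1 = Q.skeleton.dist x z := by
  have comm : ∀ a b, Q.skeleton.dist a b = Q.skeleton.dist b a := fun _ _ => SimpleGraph.dist_comm
  have tri : ∀ a b c, Q.skeleton.dist a c ≤ Q.skeleton.dist a b + Q.skeleton.dist b c :=
    fun _ _ _ => hQ.connected.dist_triangle
  -- a point outside the halfspace has a neighbour towards a given point inside
  have step : ∀ z a, Q.skeleton.dist x z + 1 = Q.skeleton.dist u z →
      Q.skeleton.dist u a + 1 = Q.skeleton.dist x a →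
      ∃ a' z', Q.skeleton.dist u a' + 1 = Q.skeleton.dist x a' ∧ Q.Between a a' z ∧
        Q.Between a' z' z ∧ Q.skeleton.Adj z z' ∧
        Q.skeleton.dist z' u + 1 = Q.skeleton.dist z u := by
    intro z a hz ha
    obtain ⟨a', hm⟩ := hQ.exists_median u a z
    rw [isMedian_iff] at hm
    obtain ⟨h₁, h₂, h₃⟩ := hm
    unfold Between at *
    have ha' : Q.skeleton.dist u a' + 1 = Q.skeleton.dist x a' := by
      have := tri x a' a
      have := dist_le_of_adj hQ.connected e.symm a'
      omega
    rcases hk : Q.skeleton.dist z a' with _ | k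
    · obtain rfl := (hQ.connected.dist_eq_zero_iff).1 hk
      omega
    · obtain ⟨z', e', hz'⟩ := exists_adj_of_dist_eq_succ hk
      have c₁ := comm a' z'
      have c₂ := comm z' z
      have c₃ := comm a' z
      have c₄ := comm u a'
      have c₅ := comm z' u
      have c₆ := comm z u
      have t₁ := tri z' a' u
      have t₂ := dist_le_of_adj hQ.connected e' u
      have t₃ := SimpleGraph.dist_eq_one_iff_adj.2 e'
      exact ⟨a', z', ha', h₂, by omega, e', by omega⟩
  rcases hQ.bipartite z e with hz | hz
  · exact hz
  exfalso
  -- Take a violating `z` nearest to `u`. Its neighbours `z₁` and `z₂` towards `a` and `b` are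
  -- closer to `u` and still between `a` and `b`, so they lie in the halfspace.
  induction hn : Q.skeleton.dist z u using Nat.strong_induction_on generalizing z a b with
  | _ n ih =>
    obtain ⟨a', z₁, ha', h₁, h₂, e₁, h₃⟩ := step z a hz ha
    obtain ⟨b', z₂, hb', h₁', h₂', e₂, h₃'⟩ := step z b hz hb
    unfold Between at *
    have t₁ := tri a z₁ b
    have t₂ := tri a a' z₁
    have t₃ := tri z₁ z b
    have d₁ := SimpleGraph.dist_eq_one_iff_adj.2 e₁
    have d₂ := SimpleGraph.dist_eq_one_iff_adj.2 e₂
    have c₁ := comm z z₁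
    have c₂ := comm z z₂
    have c₃ := comm b z
    have t₄ := tri b b' z₂
    have c₄ := comm b z₂
    have t₅ := tri a z₂ b
    have t₆ := tri a z z₂
    have t₇ := tri a z₁ z
    have t₈ := tri z z₂ b
    have o₁ : Q.skeleton.dist z₁ x + 1 = Q.skeleton.dist z₁ u → False := by
      intro h
      refine ih (Q.skeleton.dist z₁ u) (by omega) (z := z₁) (a := a) (b := b) ha hb ?_ ?_ rfl
      · omega
      · rw [comm x, comm u]; exact h
    have o₂ : Q.skeleton.dist z₂ x + 1 = Q.skeleton.dist z₂ u → False := by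
      intro h
      refine ih (Q.skeleton.dist z₂ u) (by omega) (z := z₂) (a := a) (b := b) ha hb ?_ ?_ rfl
      · omega
      · rw [comm x, comm u]; exact h
    have hne : z₁ ≠ z₂ := by rintro rfl; omega
    obtain ⟨t, hs, ht⟩ := hQ.quadrangle e₁ e₂ hne h₃ h₃'
    have q₃ := hQ.bipartite t e
    have c₅ := comm u z₁
    have c₆ := comm x z₁
    have c₇ := comm u z₂
    have c₈ := comm x z₂
    have c₉ := comm u t
    have c₁₀ := comm x t
    have c₁₁ := comm u z
    have c₁₂ := comm x z
    have q₁ := (hQ.bipartite z₁ e).resolve_right fun h => o₁ (by omega)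
    have q₂ := (hQ.bipartite z₂ e).resolve_right fun h => o₂ (by omega)
    have a₁ := dist_le_of_adj hQ.connected hs.adj₂ x
    have a₂ := dist_le_of_adj hQ.connected hs.adj₂.symm x
    -- Seen from `z₁`, both `z` and `t` are closer to `x`. Uniqueness of squares identifies the
    -- corner `q` with `z₂`, which is too far from `x`.
    obtain ⟨q, hsq, hq⟩ := hQ.quadrangle e₁.symm hs.adj₂ hs.ne (t := x) (by omega) (by omega)
    obtain rfl := hsq.unique hs.rotate.reflect
    omega

/-! ### Iterated joins of intervals -/

/-- The union of the intervals between points of `A`. -/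
def vertexJoin (Q : CubeComplex V) (A : Set V) : Set V :=
  {w | ∃ x ∈ A, ∃ y ∈ A, Q.Between x w y}

theorem subset_vertexJoin (A : Set V) : A ⊆ Q.vertexJoin A :=
  fun x hx => ⟨x, hx, x, hx, by simp [Between]⟩

theorem vertexJoin_iterate_mono (A : Set V) :
    Monotone fun k => (Q.vertexJoin)^[k] A := by
  refine monotone_nat_of_le_succ fun k => ?_
  rw [Function.iterate_succ_apply']
  exact subset_vertexJoin _

/-- Otherwise the halfspace of `u` would contain `A`, hence by convexity its iterated joins, and so
`x`. -/
theorem IsModular.exists_mem_of_mem_iterate (hQ : Q.IsModular) {A : Set V} {k : ℕ} {u x : V}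
    (hx : x ∈ (Q.vertexJoin)^[k] A) (e : Q.skeleton.Adj u x) :
    ∃ a ∈ A, Q.skeleton.dist u a + 1 ≠ Q.skeleton.dist x a := by
  by_contra! hA
  have key : ∀ (k : ℕ), ∀ z ∈ (Q.vertexJoin)^[k] A,
      Q.skeleton.dist u z + 1 = Q.skeleton.dist x z := by
    intro k
    induction k with
    | zero => exact hA
    | succ k ih =>
      intro z hz
      rw [Function.iterate_succ_apply'] at hz
      obtain ⟨a, ha, b, hb, h⟩ := hz
      exact hQ.halfspace_convex e (ih a ha) (ih b hb) h
  have := key k x hx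
  simp at this

/-- In dimension at most `r`, the `r`-th iterated join is convex. -/
theorem IsCAT0.vertexJoin_iterate_subset (hQ : Q.IsCAT0) {r : ℕ} (hr : Q.DimLE r) (A : Set V)
    (k : ℕ) : (Q.vertexJoin)^[k] A ⊆ (Q.vertexJoin)^[r] A := by
  classical
  intro x hx
  have hM := hQ.isModular
  have tri : ∀ a b c, Q.skeleton.dist a c ≤ Q.skeleton.dist a b + Q.skeleton.dist b c :=
    fun _ _ _ => hM.connected.dist_triangle
  -- Here `j` bounds the number of neighbours of `x` that lie towards `y`. Each further join
  -- replaces `y` by a vertex with fewer such neighbours.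
  have key : ∀ (j i : ℕ) (y : V), y ∈ (Q.vertexJoin)^[i] A →
      (∀ S : Finset V, (∀ u ∈ S, Q.skeleton.Adj x u ∧
        Q.skeleton.dist u y + 1 = Q.skeleton.dist x y) → S.card ≤ j) →
      x ∈ (Q.vertexJoin)^[i + j] A := by
    intro j
    induction j with
    | zero =>
      intro i y hy hS
      rcases hd : Q.skeleton.dist x y with _ | d
      · obtain rfl := (hM.connected.dist_eq_zero_iff).1 hd
        exact hy
      · obtain ⟨u, e, hu⟩ := exists_adj_of_dist_eq_succ hd
        have := hS {u} (by simp [e, hu, hd])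
        simp at this
    | succ j ih =>
      intro i y hy hS
      rcases hd : Q.skeleton.dist x y with _ | d
      · obtain rfl := (hM.connected.dist_eq_zero_iff).1 hd
        exact vertexJoin_iterate_mono A (by omega) hy
      · obtain ⟨u, e, hu⟩ := exists_adj_of_dist_eq_succ hd
        obtain ⟨a, ha, hau⟩ := hM.exists_mem_of_mem_iterate hx e.symm
        -- Neighbours of `x` towards `w` lie towards both `y` and `a`. This excludes `u`, which lies
        -- towards `y` but not towards `a`.
        obtain ⟨w, hw⟩ := hM.exists_median x y a
        rw [isMedian_iff] at hw
        obtain ⟨h₁, h₂, h₃⟩ := hw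
        have hwJ : w ∈ (Q.vertexJoin)^[i + 1] A := by
          rw [Function.iterate_succ_apply']
          exact ⟨y, hy, a, vertexJoin_iterate_mono A (Nat.zero_le i) ha, h₂⟩
        have := ih (i + 1) w hwJ fun S hS' => ?_
        · rwa [show i + (j + 1) = i + 1 + j by ring]
        unfold Between at *
        have closer : ∀ s b, Q.skeleton.Adj x s →
            Q.skeleton.dist x w + Q.skeleton.dist w b = Q.skeleton.dist x b →
            Q.skeleton.dist s w + 1 = Q.skeleton.dist x w →
            Q.skeleton.dist s b + 1 = Q.skeleton.dist x b := by
          intro s b es hb hs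
          have := tri s w b
          have := dist_le_of_adj hM.connected es b
          omega
        have huS : u ∉ S := fun hu' => hau (closer u a e h₃ (hS' u hu').2)
        have := hS (insert u S) (by
          intro s hs
          rcases Finset.mem_insert.1 hs with rfl | hs
          · exact ⟨e, by omega⟩
          · exact ⟨(hS' s hs).1, closer s y (hS' s hs).1 h₁ (hS' s hs).2⟩)
        rw [Finset.card_insert_of_notMem huS] at this
        omega
  have hA : A.Nonempty := by
    by_contra h
    rw [Set.not_nonempty_iff_eq_empty] at h
    subst h
    have : ∀ k, (Q.vertexJoin)^[k] ∅ = ∅ := by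
      intro k
      induction k with
      | zero => rfl
      | succ k ih => rw [Function.iterate_succ_apply', ih]; simp [vertexJoin]
    rw [this] at hx
    exact hx
  obtain ⟨a, ha⟩ := hA
  -- Neighbours towards a common vertex pairwise span squares by the quadrangle condition, so there
  -- are at most `r` of them.
  have := key r 0 a ha fun S hS => hQ.2.card_le hr (x := x) (fun y hy => (hS y hy).1) (by
    intro y hy z hz hne
    obtain ⟨w, hw, _⟩ := hM.quadrangle (hS y hy).1 (hS z hz).1 hne (hS y hy).2 (hS z hz).2
    exact ⟨w, hw⟩)
  simpa using this

end CubeComplex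
end LQC

namespace LQC

variable {X : Type u}

/-! ### Joins and hulls in a coarse median space -/

theorem mem_join {m : X → X → X → X} {A : Set X} {y : X} :
    y ∈ join m A ↔ ∃ a ∈ A, ∃ b ∈ A, ∃ z, m a b z = y := by
  simp [join, interval]

theorem join_mono (m : X → X → X → X) : Monotone (join m) := by
  intro A B hAB y hy
  rw [mem_join] at hy ⊢
  obtain ⟨a, ha, b, hb, z, hz⟩ := hy
  exact ⟨a, hAB ha, b, hAB hb, z, hz⟩

theorem hull_mono (m : X → X → X → X) (r : ℕ) : Monotone (hull m r) :=
  (join_mono m).iterate r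

theorem hull_nonempty (m : X → X → X → X) (r : ℕ) {A : Set X} (hA : A.Nonempty) :
    (hull m r A).Nonempty := by
  unfold hull
  induction r with
  | zero => exact hA
  | succ r ih =>
    rw [Function.iterate_succ_apply']
    obtain ⟨a, ha⟩ := ih
    exact ⟨m a a a, mem_join.2 ⟨a, ha, a, ha, a, rfl⟩⟩

theorem exists_mem_hull_of_mem_hull_iUnion {m : X → X → X → X} {r : ℕ} {A : ℕ → Set X}
    (hA : Monotone A) {y : X} (hy : y ∈ hull m r (⋃ N, A N)) : ∃ N, y ∈ hull m r (A N) := by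
  unfold hull at *
  induction r generalizing y with
  | zero => exact Set.mem_iUnion.1 hy
  | succ r ih =>
    rw [Function.iterate_succ_apply', mem_join] at hy
    obtain ⟨a, ha, b, hb, z, hz⟩ := hy
    obtain ⟨N, hN⟩ := ih ha
    obtain ⟨M, hM⟩ := ih hb
    refine ⟨max N M, ?_⟩
    rw [Function.iterate_succ_apply', mem_join]
    exact ⟨a, hull_mono m r (hA (le_max_left N M)) hN, b,
      hull_mono m r (hA (le_max_right N M)) hM, z, hz⟩

/-! ### Transfer of joins between the space and a cube complex -/

/-- How many auxiliary points are used in writing a point of the `j`-th iterated join. -/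
def auxCard : ℕ → ℕ
  | 0 => 1
  | j + 1 => auxCard j + auxCard j + 1

/-- The error made in lifting a point of the `j`-th iterated join to a cube complex. -/
def liftConst (h : ℕ → ℕ) (L D : ℝ) : ℕ → ℝ
  | 0 => D + (h 1 * (D + D + D) + h 0) + L
  | j + 1 => D + (h 1 * (liftConst h L D j + liftConst h L D j + D) + h 0)

/-- The error made in mapping a point of the `j`-th iterated join in a cube complex. -/
def projConst (h : ℕ → ℕ) (D : ℝ) : ℕ → ℝ
  | 0 => D
  | j + 1 => D + (h 1 * (projConst h D j + projConst h D j) + h 0)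

open CubeComplex

variable [MetricSpace X]

/-- Replay in `Q` the medians that produce `y`. The set `B` is fixed before `Q`, because `Q` will be
chosen to approximate `B` and `F`. The extra join in `j + 1` accounts for points of `A` lying only
coarsely in the join of `F`. -/
theorem exists_lift {m : X → X → X → X} {h : ℕ → ℕ}
    (hm : ∀ x y z x' y' z' : X,
      dist (m x y z) (m x' y' z') ≤ h 1 * (dist x x' + dist y y' + dist z z') + h 0)
    {F A : Set X} {L : ℝ} (hL : 0 ≤ L)
    (hA : ∀ y ∈ A, y ∈ F ∨ ∃ s ∈ F, ∃ t ∈ F, dist (m s t y) y ≤ L) (j : ℕ) :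
    ∀ y ∈ (join m)^[j] A, ∃ B : Finset X, B.card ≤ auxCard j ∧
      ∀ (V : Type u) (Q : CubeComplex V) (D : ℝ) (f : V → X) (g : X → V), Q.IsModular → 0 ≤ D →
        (∀ a b c w : V, Q.IsMedian a b c w → dist (f w) (m (f a) (f b) (f c)) ≤ D) →
        (∀ b, b ∈ F ∨ b ∈ B → dist b (f (g b)) ≤ D) →
        ∃ q ∈ (Q.vertexJoin)^[j + 1] (g '' F), dist (f q) y ≤ liftConst h L D j := by
  classical
  induction j with
  | zero =>
    intro y hy
    refine ⟨{y}, by simp [auxCard], fun V Q D f g hQ hD hf hg => ?_⟩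
    rcases hA y hy with hyF | ⟨s, hs, t, ht, hst⟩
    · refine ⟨g y, subset_vertexJoin _ ⟨y, hyF, rfl⟩, ?_⟩
      have := hg y (.inl hyF)
      rw [dist_comm]
      have : (0 : ℝ) ≤ h 1 * (D + D + D) + h 0 := by positivity
      simp only [liftConst]
      linarith
    · obtain ⟨q, hq⟩ := hQ.exists_median (g s) (g t) (g y)
      refine ⟨q, ⟨g s, ⟨s, hs, rfl⟩, g t, ⟨t, ht, rfl⟩, (isMedian_iff.1 hq).1⟩, ?_⟩
      have h₁ := hf _ _ _ _ hq
      have h₂ := hm (f (g s)) (f (g t)) (f (g y)) s t y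
      have h₃ := hg s (.inl hs)
      have h₄ := hg t (.inl ht)
      have h₅ := hg y (.inr (by simp))
      rw [dist_comm] at h₃ h₄ h₅
      have h₆ := dist_triangle4 (f q) (m (f (g s)) (f (g t)) (f (g y))) (m s t y) y
      have h₇ : (h 1 : ℝ) * (dist (f (g s)) s + dist (f (g t)) t + dist (f (g y)) y) ≤
          h 1 * (D + D + D) := by gcongr
      simp only [liftConst]
      linarith
  | succ j ih =>
    intro y hy
    rw [Function.iterate_succ_apply', mem_join] at hy
    obtain ⟨a, ha, b, hb, z, rfl⟩ := hy
    obtain ⟨Ba, hBa, ha⟩ := ih a ha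
    obtain ⟨Bb, hBb, hb⟩ := ih b hb
    refine ⟨insert z (Ba ∪ Bb), ?_, fun V Q D f g hQ hD hf hg => ?_⟩
    · have h₁ := Finset.card_insert_le z (Ba ∪ Bb)
      have h₂ := Finset.card_union_le Ba Bb
      simp only [auxCard]
      omega
    · obtain ⟨qa, hqa, h₁⟩ := ha V Q D f g hQ hD hf fun x hx =>
        hg x (hx.imp_right fun hx => by simp [hx])
      obtain ⟨qb, hqb, h₂⟩ := hb V Q D f g hQ hD hf fun x hx =>
        hg x (hx.imp_right fun hx => by simp [hx])
      obtain ⟨q, hq⟩ := hQ.exists_median qa qb (g z)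
      refine ⟨q, ?_, ?_⟩
      · rw [Function.iterate_succ_apply']
        exact ⟨qa, hqa, qb, hqb, (isMedian_iff.1 hq).1⟩
      have h₃ := hf _ _ _ _ hq
      have h₄ := hm (f qa) (f qb) (f (g z)) a b z
      have h₅ := hg z (.inr (by simp))
      rw [dist_comm] at h₅
      have h₆ := dist_triangle (f q) (m (f qa) (f qb) (f (g z))) (m a b z)
      have h₇ : (h 1 : ℝ) * (dist (f qa) a + dist (f qb) b + dist (f (g z)) z) ≤
          h 1 * (liftConst h L D j + liftConst h L D j + D) := by gcongr
      rw [liftConst]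
      linarith

/-- A vertex between `a` and `b` is its own median with them, so its image is close to a median
lying in the join. -/
theorem exists_near_image {m : X → X → X → X} {h : ℕ → ℕ}
    (hm : ∀ x y z x' y' z' : X,
      dist (m x y z) (m x' y' z') ≤ h 1 * (dist x x' + dist y y' + dist z z') + h 0)
    {F : Set X} {V : Type u} {Q : CubeComplex V} {D : ℝ} {f : V → X} {g : X → V}
    (hf : ∀ a b c w : V, Q.IsMedian a b c w → dist (f w) (m (f a) (f b) (f c)) ≤ D)
    (hg : ∀ b ∈ F, dist b (f (g b)) ≤ D) (j : ℕ) :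
    ∀ q ∈ (Q.vertexJoin)^[j] (g '' F), ∃ y ∈ (join m)^[j] F, dist y (f q) ≤ projConst h D j := by
  induction j with
  | zero =>
    rintro _ ⟨b, hb, rfl⟩
    exact ⟨b, hb, hg b hb⟩
  | succ j ih =>
    intro q hq
    rw [Function.iterate_succ_apply'] at hq
    obtain ⟨a, ha, b, hb, hab⟩ := hq
    obtain ⟨ya, hya, h₁⟩ := ih a ha
    obtain ⟨yb, hyb, h₂⟩ := ih b hb
    refine ⟨m ya yb (f q), ?_, ?_⟩
    · rw [Function.iterate_succ_apply', mem_join]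
      exact ⟨ya, hya, yb, hyb, f q, rfl⟩
    have h₃ := hf a b q q (isMedian_iff.2 ⟨hab, by simp [Between], by simp [Between]⟩)
    have h₄ := hm ya yb (f q) (f a) (f b) (f q)
    have h₅ := dist_triangle (m ya yb (f q)) (m (f a) (f b) (f q)) (f q)
    rw [dist_comm] at h₃
    rw [dist_self, add_zero] at h₄
    have h₆ : (h 1 : ℝ) * (dist ya (f a) + dist yb (f b)) ≤
        h 1 * (projConst h D j + projConst h D j) := by gcongr
    simp only [projConst]
    linarith

/-- How far the hull of a set may be from the hull of `c` points which span it up to `L`. -/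
def hullConst (h : ℕ → ℕ) (r c : ℕ) (L : ℝ) : ℝ :=
  liftConst h L (h (auxCard r + c)) r + projConst h (h (auxCard r + c)) r

theorem IsCoarseMedian.exists_near_hull {m : X → X → X → X} {h : ℕ → ℕ} {r : ℕ}
    (hX : IsCoarseMedian m h r) {F : Finset X} {A : Set X} {L : ℝ} {c : ℕ} (hL : 0 ≤ L)
    (hF : F.Nonempty) (hc : F.card ≤ c)
    (hA : ∀ y ∈ A, y ∈ F ∨ ∃ s ∈ F, ∃ t ∈ F, dist (m s t y) y ≤ L) {y : X}
    (hy : y ∈ hull m r A) : ∃ y' ∈ hull m r F, dist y' y ≤ hullConst h r c L := by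
  classical
  obtain ⟨B, hB, hlift⟩ := exists_lift hX.lipschitz (F := F) hL hA r y hy
  have hcard := Finset.card_union_le B F
  obtain ⟨V, _, Q, hQ, hr, f, g, hf, hg⟩ := hX.approx (auxCard r + c) (B ∪ F)
    (hF.mono Finset.subset_union_right) (by omega)
  obtain ⟨a₀, ha₀⟩ := hF
  let g' : X → V := fun x => if hx : x ∈ B ∪ F then g ⟨x, hx⟩ else
    g ⟨a₀, Finset.mem_union_right _ ha₀⟩
  have hg' : ∀ b, b ∈ (F : Set X) ∨ b ∈ B → dist b (f (g' b)) ≤ h (auxCard r + c) := by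
    intro b hb
    have hb' : b ∈ B ∪ F := by
      rcases hb with hb | hb
      · exact Finset.mem_union_right _ hb
      · exact Finset.mem_union_left _ hb
    simp only [g', dif_pos hb']
    exact hg ⟨b, hb'⟩
  obtain ⟨q, hq, hqy⟩ := hlift V Q _ f g' hQ.isModular (Nat.cast_nonneg _) hf hg'
  -- The lift lies in the join of order `r + 1`, which in dimension at most `r` is contained in the
  -- one of order `r`.
  obtain ⟨y', hy', hqy'⟩ := exists_near_image hX.lipschitz hf (fun b hb => hg' b (.inl hb)) r q
    (hQ.vertexJoin_iterate_subset hr _ _ hq)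
  refine ⟨y', hy', (dist_triangle _ (f q) _).trans ?_⟩
  unfold hullConst
  linarith

end LQC

namespace LQC

open Filter

/-! ### Ultralimits of pointed cube complexes -/

theorem exists_eventually_of_finite {ι : Type*} [Finite ι] {ω : Ultrafilter ℕ} {P : ι → ℕ → Prop}
    (h : ∀ᶠ N in ω, ∃ i, P i N) : ∃ i, ∀ᶠ N in ω, P i N := by
  by_contra! hne
  have h' : ∀ᶠ N in ω, ∀ i, ¬ P i N :=
    eventually_all.2 hne
  obtain ⟨N, ⟨i, hi⟩, hN⟩ := (h.and h').exists
  exact hN i hi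

theorem exists_eventually_seq {V : ℕ → Type u} (o : ∀ N, V N) {ω : Ultrafilter ℕ}
    {P : ∀ N, V N → Prop} (h : ∀ᶠ N in ω, ∃ z, P N z) :
    ∃ a : ∀ N, V N, ∀ᶠ N in ω, P N (a N) := by
  classical
  refine ⟨fun N => if hN : ∃ z, P N z then hN.choose else o N, h.mono fun N hN => ?_⟩
  simp only [dif_pos hN]
  exact hN.choose_spec

namespace CubeComplex

variable {V : ℕ → Type u} (Q : ∀ N, CubeComplex (V N)) (o : ∀ N, V N) (ω : Ultrafilter ℕ)

/-- Sequences of vertices at bounded distance from the base vertices, up to equality almost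
everywhere. -/
def limitSetoid : Setoid {a : ∀ N, V N // ∃ R : ℕ, ∀ᶠ N in ω, (Q N).skeleton.dist (o N) (a N) ≤ R}
    where
  r a b := ∀ᶠ N in ω, a.1 N = b.1 N
  iseqv := ⟨fun _ => Eventually.of_forall fun _ => rfl, fun h => h.mono fun _ => Eq.symm,
    fun h h' => (h.and h').mono fun _ h => h.1.trans h.2⟩

/-- The vertices of the ultralimit of a sequence of pointed cube complexes. -/
def Limit : Type u := Quotient (limitSetoid Q o ω)

variable {Q o ω}

/-- A sequence representing a vertex of the ultralimit. -/
noncomputable def Limit.rep (x : Limit Q o ω) (N : ℕ) : V N := (Quotient.out x).1 N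

theorem Limit.bounded (x : Limit Q o ω) :
    ∃ R : ℕ, ∀ᶠ N in ω, (Q N).skeleton.dist (o N) (x.rep N) ≤ R := (Quotient.out x).2

theorem Limit.ext {x y : Limit Q o ω} (h : ∀ᶠ N in ω, x.rep N = y.rep N) : x = y :=
  Quotient.out_equiv_out.1 h

theorem Limit.exists_rep_of_bounded (a : ∀ N, V N) {R : ℕ}
    (h : ∀ᶠ N in ω, (Q N).skeleton.dist (o N) (a N) ≤ R) :
    ∃ x : Limit Q o ω, ∀ᶠ N in ω, x.rep N = a N :=
  ⟨Quotient.mk (limitSetoid Q o ω) ⟨a, R, h⟩,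
    Quotient.mk_out (s := limitSetoid Q o ω) ⟨a, R, h⟩⟩

variable (Q o ω) in
/-- The ultralimit of a sequence of pointed cube complexes. -/
def limit : CubeComplex (Limit Q o ω) where
  IsCube n c := ∀ᶠ N in ω, (Q N).IsCube n fun α => (c α).rep N
  injective := by
    intro n c hc α β h
    obtain ⟨N, hN⟩ := hc.exists
    exact (Q N).injective hN (by simp only [h])
  vertex x := Eventually.of_forall fun N => (Q N).vertex _
  face hc hφ := hc.mono fun N hN => (Q N).face hN hφ
  inter := by
    rintro n n' c c' hc hc' ⟨_, ⟨α₀, rfl⟩, ⟨β₀, hβ₀⟩⟩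
    have h : ∀ᶠ N in ω, ∃ i : Σ k : Fin (n + 1), ((Fin k → Bool) → (Fin n → Bool)) ×
        ((Fin k → Bool) → (Fin n' → Bool)), IsFaceMap i.2.1 ∧ IsFaceMap i.2.2 ∧
        (fun α => (c α).rep N) ∘ i.2.1 = (fun α => (c' α).rep N) ∘ i.2.2 ∧
        Set.range (fun α => (c α).rep N) ∩ Set.range (fun α => (c' α).rep N) =
          Set.range ((fun α => (c α).rep N) ∘ i.2.1) := by
      filter_upwards [hc, hc'] with N hN hN'
      obtain ⟨k, φ, φ', hφ, hφ', h₁, h₂⟩ := (Q N).inter hN hN'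
        ⟨(c α₀).rep N, ⟨α₀, rfl⟩, ⟨β₀, by simp only [hβ₀]⟩⟩
      -- Bounding `k` leaves finitely many triples `(k, φ, φ')`, so one of them works for almost
      -- every `N`.
      have hk : k ≤ n := by
        have := Fintype.card_le_of_injective φ hφ.injective
        simpa [Nat.pow_le_pow_iff_right] using this
      exact ⟨⟨⟨k, by omega⟩, φ, φ'⟩, hφ, hφ', h₁, h₂⟩
    obtain ⟨⟨k, φ, φ'⟩, h⟩ := exists_eventually_of_finite h
    obtain ⟨N₀, hφ, hφ', -, -⟩ := h.exists
    have heq : c ∘ φ = c' ∘ φ' := by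
      funext κ
      exact Limit.ext (h.mono fun N hN => congrFun hN.2.2.1 κ)
    refine ⟨k, φ, φ', hφ, hφ', heq, Set.Subset.antisymm ?_ ?_⟩
    · rintro _ ⟨⟨α, rfl⟩, ⟨β, hβ⟩⟩
      obtain ⟨N, hN, -, -, -, hr⟩ := (hc.and h).exists
      have : (c α).rep N ∈ Set.range ((fun α => (c α).rep N) ∘ φ) :=
        hr ▸ ⟨⟨α, rfl⟩, ⟨β, by simp only [hβ]⟩⟩
      obtain ⟨κ, hκ⟩ := this
      exact ⟨κ, congrArg c ((Q N).injective hN hκ)⟩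
    · rintro _ ⟨κ, rfl⟩
      exact ⟨⟨φ κ, rfl⟩, ⟨φ' κ, (congrFun heq κ).symm⟩⟩

theorem limit_adj_iff {x y : Limit Q o ω} : (limit Q o ω).skeleton.Adj x y ↔
    ∀ᶠ N in ω, (Q N).skeleton.Adj (x.rep N) (y.rep N) := by
  constructor
  · rintro ⟨c, hc, rfl, rfl⟩
    exact hc.mono fun N hN => ⟨_, hN, rfl, rfl⟩
  · intro h
    refine ⟨fun α => if α 0 then y else x, h.mono fun N hN => ?_, by simp, by simp⟩
    obtain ⟨c, hc, h₀, h₁⟩ := hN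
    convert hc using 1
    funext α
    have hα : α = ![α 0] := by ext l; fin_cases l; rfl
    rw [hα]
    cases α 0 <;> simp [h₀, h₁]

theorem limit_isSquare_iff {x y z w : Limit Q o ω} : (limit Q o ω).IsSquare x y z w ↔
    ∀ᶠ N in ω, (Q N).IsSquare (x.rep N) (y.rep N) (z.rep N) (w.rep N) := by
  constructor
  · rintro ⟨c, hc, rfl, rfl, rfl, rfl⟩
    exact hc.mono fun N hN => ⟨_, hN, rfl, rfl, rfl, rfl⟩
  · intro h
    refine ⟨fun α => if α 0 then (if α 1 then z else y) else (if α 1 then w else x),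
      h.mono fun N hN => ?_, by simp, by simp, by simp, by simp⟩
    obtain ⟨c, hc, h₀, h₁, h₂, h₃⟩ := hN
    convert hc using 1
    funext α
    have hα : α = ![α 0, α 1] := by ext l; fin_cases l <;> rfl
    rw [hα]
    cases α 0 <;> cases α 1 <;> simp [h₀, h₁, h₂, h₃]

/-! ### Distances in the ultralimit -/

theorem Limit.exists_rep_of_dist_le (hQ : ∀ N, (Q N).skeleton.Connected) (x : Limit Q o ω)
    (a : ∀ N, V N) {R : ℕ} (h : ∀ᶠ N in ω, (Q N).skeleton.dist (x.rep N) (a N) ≤ R) :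
    ∃ y : Limit Q o ω, ∀ᶠ N in ω, y.rep N = a N := by
  obtain ⟨R', h'⟩ := x.bounded
  refine Limit.exists_rep_of_bounded a (R := R' + R) ?_
  filter_upwards [h, h'] with N h h'
  have := (hQ N).dist_triangle (u := o N) (v := x.rep N) (w := a N)
  omega

/-- These distances are almost always bounded, so they take finitely many values and the ultrafilter
selects one. -/
theorem exists_eventually_dist_eq (hQ : ∀ N, (Q N).skeleton.Connected) (x y : Limit Q o ω) :
    ∃ d, ∀ᶠ N in ω, (Q N).skeleton.dist (x.rep N) (y.rep N) = d := by
  obtain ⟨R, h⟩ := x.bounded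
  obtain ⟨R', h'⟩ := y.bounded
  have : ∀ᶠ N in ω, ∃ d : Fin (R + R' + 1), (Q N).skeleton.dist (x.rep N) (y.rep N) = d := by
    filter_upwards [h, h'] with N h h'
    have := (hQ N).dist_triangle (u := x.rep N) (v := o N) (w := y.rep N)
    rw [SimpleGraph.dist_comm (u := x.rep N) (v := o N)] at this
    exact ⟨⟨(Q N).skeleton.dist (x.rep N) (y.rep N), by omega⟩, rfl⟩
  obtain ⟨d, hd⟩ := exists_eventually_of_finite this
  exact ⟨d, hd⟩

theorem eventually_dist_le_length (hQ : ∀ N, (Q N).skeleton.Connected) {x y : Limit Q o ω}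
    (p : (limit Q o ω).skeleton.Walk x y) :
    ∀ᶠ N in ω, (Q N).skeleton.dist (x.rep N) (y.rep N) ≤ p.length := by
  induction p with
  | nil => simp
  | @cons x z y e p ih =>
    filter_upwards [ih, limit_adj_iff.1 e] with N h e
    have := dist_le_of_adj (hQ N) e (y.rep N)
    simp only [SimpleGraph.Walk.length_cons]
    omega

theorem exists_walk_of_eventually_dist_eq (hQ : ∀ N, (Q N).skeleton.Connected) {d : ℕ}
    {x y : Limit Q o ω} (h : ∀ᶠ N in ω, (Q N).skeleton.dist (x.rep N) (y.rep N) = d) :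
    ∃ p : (limit Q o ω).skeleton.Walk x y, p.length = d := by
  induction d generalizing x with
  | zero =>
    obtain rfl : x = y := Limit.ext (h.mono fun N hN => ((hQ N).dist_eq_zero_iff).1 hN)
    exact ⟨.nil, rfl⟩
  | succ d ih =>
    obtain ⟨a, ha⟩ := exists_eventually_seq o (h.mono fun N hN => exists_adj_of_dist_eq_succ hN)
    obtain ⟨z, hz⟩ := Limit.exists_rep_of_dist_le hQ x a (R := 1)
      (ha.mono fun N hN => (SimpleGraph.dist_eq_one_iff_adj.2 hN.1).le)
    obtain ⟨p, hp⟩ := ih (x := z) (by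
      filter_upwards [ha, hz] with N ha hz
      rw [hz]; exact ha.2)
    refine ⟨.cons (limit_adj_iff.2 ?_) p, by simp [hp]⟩
    filter_upwards [ha, hz] with N ha hz
    rw [hz]; exact ha.1

theorem limit_connected (hQ : ∀ N, (Q N).skeleton.Connected) :
    (limit Q o ω).skeleton.Connected := by
  obtain ⟨x, -⟩ := Limit.exists_rep_of_bounded (Q := Q) (o := o) (ω := ω) o (R := 0)
    (Eventually.of_forall fun N => by simp)
  have : Nonempty (Limit Q o ω) := ⟨x⟩
  refine ⟨fun x y => ?_⟩
  obtain ⟨d, hd⟩ := exists_eventually_dist_eq hQ x y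
  obtain ⟨p, -⟩ := exists_walk_of_eventually_dist_eq hQ hd
  exact ⟨p⟩

theorem eventually_dist_eq (hQ : ∀ N, (Q N).skeleton.Connected) (x y : Limit Q o ω) :
    ∀ᶠ N in ω, (Q N).skeleton.dist (x.rep N) (y.rep N) = (limit Q o ω).skeleton.dist x y := by
  obtain ⟨d, hd⟩ := exists_eventually_dist_eq hQ x y
  obtain ⟨p, hp⟩ := exists_walk_of_eventually_dist_eq hQ hd
  obtain ⟨q, hq⟩ := ((limit_connected hQ).preconnected x y).exists_walk_length_eq_dist
  have h₁ := SimpleGraph.dist_le p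
  filter_upwards [hd, eventually_dist_le_length hQ q] with N h₂ h₃
  omega

/-! ### Properties inherited by the ultralimit -/

theorem limit_isModular (hQ : ∀ N, (Q N).IsModular) : (limit Q o ω).IsModular where
  connected := limit_connected fun N => (hQ N).connected
  bipartite := by
    intro x y t e
    have hd := eventually_dist_eq (o := o) (ω := ω) fun N => (hQ N).connected
    obtain ⟨N, h₁, h₂, h₃⟩ := ((limit_adj_iff.1 e).and ((hd x t).and (hd y t))).exists
    rw [← h₂, ← h₃]
    exact (hQ N).bipartite _ h₁
  quadrangle := by
    intro x y w t e e' hne h h'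
    have hd := eventually_dist_eq (o := o) (ω := ω) fun N => (hQ N).connected
    have hne' : ∀ᶠ N in ω, y.rep N ≠ w.rep N :=
      Ultrafilter.eventually_not.2 fun h => hne (Limit.ext h)
    have hex : ∀ᶠ N in ω, ∃ z, (Q N).IsSquare (x.rep N) (y.rep N) z (w.rep N) ∧
        (Q N).skeleton.dist z (t.rep N) + 2 = (Q N).skeleton.dist (x.rep N) (t.rep N) := by
      filter_upwards [limit_adj_iff.1 e, limit_adj_iff.1 e', hne', hd x t, hd y t, hd w t]
        with N e e' hne h₁ h₂ h₃
      exact (hQ N).quadrangle e e' hne (by omega) (by omega)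
    obtain ⟨a, ha⟩ := exists_eventually_seq o hex
    obtain ⟨z, hz⟩ := Limit.exists_rep_of_dist_le (fun N => (hQ N).connected) y a (R := 1)
      (ha.mono fun N hN => (SimpleGraph.dist_eq_one_iff_adj.2 hN.1.adj₂).le)
    refine ⟨z, limit_isSquare_iff.2 ?_, ?_⟩
    · filter_upwards [ha, hz] with N ha hz
      rw [hz]; exact ha.1
    · obtain ⟨N, h₁, h₂, h₃, h₄⟩ := (ha.and (hz.and ((hd z t).and (hd x t)))).exists
      rw [← h₃, ← h₄, h₂]
      exact h₁.2

theorem limit_dimLE {v : ℕ} (hv : ∀ N, (Q N).DimLE v) : (limit Q o ω).DimLE v := by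
  intro n c hc
  obtain ⟨N, hN⟩ := Eventually.exists hc
  exact hv N n _ hN

/-- The dimension bound lets one cube dimension `n` serve almost every `N`. The vertices of those
cubes stay within `n` of `x`, so they define vertices of the ultralimit. -/
theorem limit_flagLinks {v : ℕ} (hQ : ∀ N, (Q N).skeleton.Connected)
    (hF : ∀ N, (Q N).FlagLinks) (hv : ∀ N, (Q N).DimLE v) : (limit Q o ω).FlagLinks := by
  classical
  intro x S hadj hsq
  have hadj' : ∀ᶠ N in ω, ∀ y ∈ S, (Q N).skeleton.Adj (x.rep N) (y.rep N) :=
    (S.eventually_all).2 fun y hy => limit_adj_iff.1 (hadj y hy)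
  have hsq' : ∀ᶠ N in ω, ∀ y ∈ S, ∀ z ∈ S, y ≠ z →
      ∃ w, (Q N).IsSquare (x.rep N) (y.rep N) w (z.rep N) := by
    refine (S.eventually_all).2 fun y hy => (S.eventually_all).2 fun z hz => ?_
    by_cases hne : y = z
    · exact Eventually.of_forall fun N h => absurd hne h
    · obtain ⟨w, hw⟩ := hsq y hy z hz hne
      exact (limit_isSquare_iff.1 hw).mono fun N hN _ => ⟨_, hN⟩
  have hex : ∀ᶠ N in ω, ∃ n : Fin (v + 1), ∃ c : (Fin n → Bool) → V N, (Q N).IsCube n c ∧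
      x.rep N ∈ Set.range c ∧ ∀ y ∈ S, y.rep N ∈ Set.range c := by
    filter_upwards [hadj', hsq'] with N h₁ h₂
    obtain ⟨n, c, hc, hx, hS⟩ := hF N (x.rep N) (S.image fun y => y.rep N) (by
        intro y hy
        obtain ⟨y, hyS, rfl⟩ := Finset.mem_image.1 hy
        exact h₁ y hyS) (by
        intro y hy z hz hne
        obtain ⟨y, hyS, rfl⟩ := Finset.mem_image.1 hy
        obtain ⟨z, hzS, rfl⟩ := Finset.mem_image.1 hz
        exact h₂ y hyS z hzS fun h => hne (by rw [h]))
    exact ⟨⟨n, Nat.lt_succ_of_le (hv N n c hc)⟩, c, hc, hx,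
      fun y hy => hS (Finset.mem_coe.2 (Finset.mem_image_of_mem _ hy))⟩
  obtain ⟨⟨n, _⟩, hn⟩ := exists_eventually_of_finite hex
  obtain ⟨c, hc⟩ := exists_eventually_seq (V := fun N => (Fin n → Bool) → V N)
    (fun N _ => o N) hn
  have hb : ∀ α, ∃ y : Limit Q o ω, ∀ᶠ N in ω, y.rep N = c N α := by
    intro α
    refine Limit.exists_rep_of_dist_le hQ x (fun N => c N α) (R := n) (hc.mono fun N hN => ?_)
    obtain ⟨hN, ⟨β, hβ⟩, -⟩ := hN
    rw [← hβ]
    obtain ⟨p, hp⟩ := hN.exists_walk_length_le β α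
    exact (SimpleGraph.dist_le p).trans hp
  choose C hC using hb
  have hC' : ∀ᶠ N in ω, ∀ α, (C α).rep N = c N α := eventually_all.2 hC
  have hmem : ∀ y : Limit Q o ω, (∀ᶠ N in ω, y.rep N ∈ Set.range (c N)) → y ∈ Set.range C := by
    intro y hy
    obtain ⟨α, hα⟩ := exists_eventually_of_finite hy
    refine ⟨α, Limit.ext ?_⟩
    filter_upwards [hα, hC'] with N h₁ h₂
    rw [h₂, h₁]
  refine ⟨n, C, ?_, hmem x (hc.mono fun N hN => hN.2.1),
    fun y hy => hmem y (hc.mono fun N hN => hN.2.2 y hy)⟩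
  filter_upwards [hc, hC'] with N h₁ h₂
  simp only [h₂]
  exact h₁.1

theorem limit_isCAT0 {v : ℕ} (hQ : ∀ N, (Q N).IsCAT0) (hv : ∀ N, (Q N).DimLE v) :
    (limit Q o ω).IsCAT0 :=
  ⟨(limit_isModular fun N => (hQ N).isModular).simplyConnected,
    limit_flagLinks (fun N => (hQ N).1.1) (fun N => (hQ N).2) hv⟩

end CubeComplex

/-! ### Truncations of median rays -/

theorem middle_zero {s t : ℝ≥0} (h : t ≤ s) : middle 0 s t = t := by
  simp [middle, h]

variable {X : Type u}

open Classical in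
/-- The given points, together with the points at times `0` and `N` on the given rays. -/
noncomputable def truncation {p n : ℕ} (x : Fin p → X) (γ : Fin n → ℝ≥0 → X) (N : ℕ) : Finset X :=
  Finset.univ.image x ∪
    (Finset.univ.image (fun i => γ i 0) ∪ Finset.univ.image (fun i => γ i N))

theorem card_truncation_le {p n : ℕ} (x : Fin p → X) (γ : Fin n → ℝ≥0 → X) (N : ℕ) :
    (truncation x γ N).card ≤ p + (n + n) := by
  classical
  unfold truncation
  refine (Finset.card_union_le _ _).trans (add_le_add ?_ ((Finset.card_union_le _ _).trans
    (add_le_add ?_ ?_))) <;> refine Finset.card_image_le.trans ?_ <;> simp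

theorem mem_truncation {p n : ℕ} {x : Fin p → X} {γ : Fin n → ℝ≥0 → X} {N : ℕ} {y : X} :
    y ∈ truncation x γ N ↔ (∃ i, x i = y) ∨ (∃ i, γ i 0 = y) ∨ ∃ i, γ i N = y := by
  simp [truncation]

/-! ### Cubical approximations of limits -/

variable [MetricSpace X]

theorem AdmitsCubicalApprox.pos {m : X → X → X → X} {v : ℕ} {K : ℝ} {H : Set X}
    (h : AdmitsCubicalApprox m v K H) : 0 < K := by
  obtain ⟨V, Q, hQ, -, f, -, hm, -⟩ := h
  obtain ⟨a⟩ := hQ.1.1.nonempty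
  exact dist_nonneg.trans_lt (hm a a a a (by simp [CubeComplex.IsMedian, CubeComplex.cdist]))

theorem AdmitsCubicalApprox.mono {m : X → X → X → X} {v : ℕ} {K K' : ℝ} {H : Set X}
    (h : AdmitsCubicalApprox m v K H) (hK : K ≤ K') : AdmitsCubicalApprox m v K' H := by
  have hpos := h.pos
  obtain ⟨V, Q, hQ, hv, f, hf, hm, hqi, hd⟩ := h
  refine ⟨V, Q, hQ, hv, f, hf, fun a b c w hw => (hm a b c w hw).trans_le hK, fun a b => ?_,
    fun x hx => (hd x hx).imp fun a ha => ha.trans hK⟩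
  have hnn : 0 ≤ Q.cdist a b := Nat.cast_nonneg _
  have h₁ : K'⁻¹ * Q.cdist a b ≤ K⁻¹ * Q.cdist a b := by gcongr
  have h₂ : K * Q.cdist a b ≤ K' * Q.cdist a b := by gcongr
  have := hqi a b
  constructor <;> linarith [this.1, this.2]

/-- A set which is exhausted, up to bounded distance, by sets with uniform cubical approximations
has a cubical approximation. -/
theorem admitsCubicalApprox_of_exhaustion [ProperSpace X] {m : X → X → X → X} {h : ℕ → ℕ}
    (hm : ∀ x y z x' y' z' : X,
      dist (m x y z) (m x' y' z') ≤ h 1 * (dist x x' + dist y y' + dist z z') + h 0)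
    {v : ℕ} {K C : ℝ} (hC : 0 ≤ C) {H : Set X} {S : ℕ → Set X} {y₀ : X}
    (hS : ∀ N, AdmitsCubicalApprox m v K (S N)) (hSH : ∀ N, S N ⊆ H) (hy₀ : ∀ N, y₀ ∈ S N)
    (hH : ∀ y ∈ H, ∀ᶠ N in atTop, ∃ y' ∈ S N, dist y' y ≤ C) :
    AdmitsCubicalApprox m v (K + C + (h 1 * 3 + h 0) + 2) H := by
  have hK := (hS 0).pos
  choose V Q hQ hv f hf hmed hqi hd using hS
  choose o ho using fun N => hd N y₀ (hy₀ N)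
  let ω : Ultrafilter ℕ := hyperfilter ℕ
  have hω : (ω : Filter ℕ) ≤ atTop := by
    rw [← Nat.cofinite_eq_atTop]; exact hyperfilter_le_cofinite
  have hcon : ∀ N, (Q N).skeleton.Connected := fun N => (hQ N).1.1
  have hdist := CubeComplex.eventually_dist_eq (o := o) (ω := ω) hcon
  have hF : ∀ a : CubeComplex.Limit Q o ω, ∃ y ∈ H, ∀ᶠ N in ω, dist y (f N (a.rep N)) ≤ 1 := by
    intro a
    obtain ⟨R, hR⟩ := a.bounded
    have hball : ∀ᶠ N in ω, f N (a.rep N) ∈ Metric.closedBall y₀ (K * R + K + K) := by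
      filter_upwards [hR] with N hN
      have h₁ := (hqi N (o N) (a.rep N)).2
      have h₂ : K * (Q N).cdist (o N) (a.rep N) ≤ K * R := by
        have : (Q N).cdist (o N) (a.rep N) ≤ R := Nat.cast_le.2 hN
        gcongr
      rw [Metric.mem_closedBall]
      have h₃ := dist_triangle_left (f N (a.rep N)) y₀ (f N (o N))
      linarith [ho N]
    -- The limit point `l` need not lie in `H`. It is replaced by a nearby value `f M (a.rep M)`,
    -- which does.
    obtain ⟨l, -, hl⟩ := (isCompact_closedBall y₀ (K * R + K + K)).ultrafilter_le_nhds
      (ω.map fun N => f N (a.rep N)) (le_principal_iff.2 hball)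
    have hl' : ∀ᶠ N in ω, dist (f N (a.rep N)) l < 1 / 2 :=
      hl (Metric.ball_mem_nhds l (by norm_num))
    obtain ⟨M, hM⟩ := hl'.exists
    refine ⟨f M (a.rep M), hSH M (hf M _), hl'.mono fun N hN => ?_⟩
    have := dist_triangle_right (f M (a.rep M)) (f N (a.rep N)) l
    linarith
  choose F hFH hF using hF
  have hh : (0 : ℝ) ≤ h 1 * 3 + h 0 := by positivity
  refine ⟨_, CubeComplex.limit Q o ω, CubeComplex.limit_isCAT0 hQ hv, CubeComplex.limit_dimLE hv,
    F, hFH, ?_, ?_, ?_⟩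
  · intro a b c w hw
    obtain ⟨N, hN⟩ := ((((hdist a w).and ((hdist w b).and (hdist a b))).and ((hdist b w).and
      ((hdist w c).and ((hdist b c).and (hdist a c))))).and
      (((hF a).and (hF b)).and ((hF c).and (hF w)))).exists
    obtain ⟨⟨⟨e₁, e₂, e₃⟩, e₄, e₅, e₆, e₇⟩, ⟨fa, fb⟩, fc, fw⟩ := hN
    have hmN : (Q N).IsMedian (a.rep N) (b.rep N) (c.rep N) (w.rep N) := by
      unfold CubeComplex.IsMedian CubeComplex.cdist at *
      rw [e₁, e₂, e₃, e₄, e₅, e₆, e₇]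
      exact hw
    have h₁ := hmed N _ _ _ _ hmN
    have h₂ := hm (f N (a.rep N)) (f N (b.rep N)) (f N (c.rep N)) (F a) (F b) (F c)
    rw [dist_comm (f N (a.rep N)), dist_comm (f N (b.rep N)), dist_comm (f N (c.rep N))] at h₂
    have h₃ : (h 1 : ℝ) * (dist (F a) (f N (a.rep N)) + dist (F b) (f N (b.rep N)) +
        dist (F c) (f N (c.rep N))) ≤ h 1 * 3 := by
      gcongr
      linarith
    have h₄ := dist_triangle4 (F w) (f N (w.rep N))
      (m (f N (a.rep N)) (f N (b.rep N)) (f N (c.rep N))) (m (F a) (F b) (F c))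
    linarith
  · intro a b
    obtain ⟨N, e, fa, fb⟩ := ((hdist a b).and ((hF a).and (hF b))).exists
    obtain ⟨h₁, h₂⟩ := hqi N (a.rep N) (b.rep N)
    have e' : (Q N).cdist (a.rep N) (b.rep N) = (CubeComplex.limit Q o ω).cdist a b := by
      unfold CubeComplex.cdist; rw [e]
    rw [e'] at h₁ h₂
    have hnn : 0 ≤ (CubeComplex.limit Q o ω).cdist a b := Nat.cast_nonneg _
    have hKK : K ≤ K + C + (h 1 * 3 + h 0) + 2 := by linarith
    have h₃ : (K + C + (h 1 * 3 + h 0) + 2)⁻¹ * (CubeComplex.limit Q o ω).cdist a b ≤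
        K⁻¹ * (CubeComplex.limit Q o ω).cdist a b := by gcongr
    have h₄ : K * (CubeComplex.limit Q o ω).cdist a b ≤
        (K + C + (h 1 * 3 + h 0) + 2) * (CubeComplex.limit Q o ω).cdist a b := by gcongr
    have h₅ := dist_triangle4 (F a) (f N (a.rep N)) (f N (b.rep N)) (F b)
    have h₆ := dist_triangle4 (f N (a.rep N)) (F a) (F b) (f N (b.rep N))
    rw [dist_comm (f N (b.rep N))] at h₅
    rw [dist_comm (f N (a.rep N)) (F a)] at h₆
    constructor <;> linarith
  · intro y hy
    have hex : ∀ᶠ N in ω, ∃ a, dist (f N a) y ≤ K + C := by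
      filter_upwards [hω (hH y hy)] with N hN
      obtain ⟨y', hy', hyC⟩ := hN
      obtain ⟨a, ha⟩ := hd N y' hy'
      exact ⟨a, (dist_triangle _ y' _).trans (add_le_add ha hyC)⟩
    obtain ⟨a, ha⟩ := exists_eventually_seq o hex
    -- The lower quasi-isometry bound keeps the vertices `a N` within `R` of the base vertices, so
    -- they represent a vertex of the ultralimit.
    obtain ⟨R, hR⟩ := exists_nat_ge (K * (K + (K + dist y₀ y + (K + C))))
    obtain ⟨x, hx⟩ := CubeComplex.Limit.exists_rep_of_bounded (Q := Q) (o := o) (ω := ω) a (R := R)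
      (by
        filter_upwards [ha] with N hN
        have h₁ := (hqi N (o N) (a N)).1
        have h₂ := dist_triangle4 (f N (o N)) y₀ y (f N (a N))
        rw [dist_comm y] at h₂
        have h₃ : K⁻¹ * (Q N).cdist (o N) (a N) ≤ K + (K + dist y₀ y + (K + C)) := by
          linarith [ho N]
        rw [inv_mul_le_iff₀ hK] at h₃
        exact Nat.cast_le.1 (h₃.trans hR))
    refine ⟨x, ?_⟩
    obtain ⟨N, h₁, h₂, h₃⟩ := (ha.and (hx.and (hF x))).exists
    rw [h₂] at h₃
    have := dist_triangle (F x) (f N (a N)) y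
    linarith

end LQC

/-! ### Hulls of points and median rays -/

theorem mainTheorem6 (h : ℕ → ℕ) (r v : ℕ) (k : ℕ → ℝ) (L : ℝ) (hL : 1 ≤ L)
    (p n : ℕ) (hpn : 0 < p + n) :
    ∃ K : ℝ, ∀ (X : Type u) [MetricSpace X] [ProperSpace X] (m : X → X → X → X),
      LQC.IsLQC m h r v k →
      ∀ (x : Fin p → X) (γ : Fin n → ℝ≥0 → X), (∀ i, LQC.IsMedianRay m L (γ i)) →
        LQC.AdmitsCubicalApprox m v K
          (LQC.hull m r ((⋃ i, Set.range (γ i)) ∪ Set.range x)) := by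
  -- The sum stands in for a maximum, since `k` need not be monotone and a truncation may have fewer
  -- than `p + 2n` points.
  refine ⟨∑ j ∈ Finset.range (p + (n + n) + 1), |k j| + |LQC.hullConst h r (p + (n + n)) L| +
    (h 1 * 3 + h 0) + 2, ?_⟩
  intro X _ _ m hX x γ hγ
  obtain ⟨a₀, ha₀⟩ : ∃ a₀, ∀ N, a₀ ∈ LQC.truncation x γ N := by
    by_cases hp : 0 < p
    · exact ⟨x ⟨0, hp⟩, fun N => LQC.mem_truncation.2 (.inl ⟨_, rfl⟩)⟩
    · exact ⟨γ ⟨0, by omega⟩ 0, fun N => LQC.mem_truncation.2 (.inr (.inl ⟨_, rfl⟩))⟩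
  obtain ⟨y₀, hy₀⟩ := LQC.hull_nonempty m r (Set.singleton_nonempty a₀)
  have hsub : ∀ N, (LQC.truncation x γ N : Set X) ⊆ (⋃ i, Set.range (γ i)) ∪ Set.range x := by
    intro N y hy
    rcases LQC.mem_truncation.1 hy with ⟨i, rfl⟩ | ⟨i, rfl⟩ | ⟨i, rfl⟩
    · exact .inr ⟨i, rfl⟩
    · exact .inl (Set.mem_iUnion.2 ⟨i, _, rfl⟩)
    · exact .inl (Set.mem_iUnion.2 ⟨i, _, rfl⟩)
  refine LQC.admitsCubicalApprox_of_exhaustion hX.coarseMedian.lipschitz (abs_nonneg _)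
    (S := fun N => LQC.hull m r (LQC.truncation x γ N)) (y₀ := y₀) (fun N => ?_)
    (fun N => LQC.hull_mono m r (hsub N))
    (fun N => LQC.hull_mono m r (by simpa using ha₀ N) hy₀) fun y hy => ?_
  · refine (hX.approx _ ⟨a₀, ha₀ N⟩).mono ((le_abs_self _).trans ?_)
    exact Finset.single_le_sum (f := fun j => |k j|) (fun j _ => abs_nonneg _)
      (Finset.mem_range.2 (Nat.lt_succ_of_le (LQC.card_truncation_le x γ N)))
  · let A : ℕ → Set X := fun N => (⋃ i, γ i '' Set.Iic (N : ℝ≥0)) ∪ Set.range x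
    have hA : Monotone A := fun N M hNM => Set.union_subset_union_left _
      (Set.iUnion_mono fun i => Set.image_mono (Set.Iic_subset_Iic.2 (Nat.cast_le.2 hNM)))
    have hAU : (⋃ i, Set.range (γ i)) ∪ Set.range x ⊆ ⋃ N, A N := by
      rintro y (hy | hy)
      · obtain ⟨i, t, rfl⟩ := Set.mem_iUnion.1 hy
        obtain ⟨N, hN⟩ := exists_nat_ge t
        exact Set.mem_iUnion.2 ⟨N, .inl (Set.mem_iUnion.2 ⟨i, t, hN, rfl⟩)⟩
      · exact Set.mem_iUnion.2 ⟨0, .inr hy⟩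
    obtain ⟨N₀, hN₀⟩ := LQC.exists_mem_hull_of_mem_hull_iUnion hA (LQC.hull_mono m r hAU hy)
    refine Filter.eventually_atTop.2 ⟨N₀, fun N hN => ?_⟩
    suffices hspan : ∀ z ∈ A N, z ∈ LQC.truncation x γ N ∨ ∃ s ∈ LQC.truncation x γ N,
        ∃ t ∈ LQC.truncation x γ N, dist (m s t z) z ≤ L by
      obtain ⟨y', hy', hd⟩ := hX.coarseMedian.exists_near_hull (F := LQC.truncation x γ N)
        (zero_le_one.trans hL) ⟨a₀, ha₀ N⟩ (LQC.card_truncation_le x γ N) hspan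
        (LQC.hull_mono m r (hA hN) hN₀)
      exact ⟨y', hy', hd.trans (le_abs_self _)⟩
    rintro z (hz | ⟨i, rfl⟩)
    · obtain ⟨i, t, ht, rfl⟩ := Set.mem_iUnion.1 hz
      refine .inr ⟨γ i 0, LQC.mem_truncation.2 (.inr (.inl ⟨i, rfl⟩)), γ i N,
        LQC.mem_truncation.2 (.inr (.inr ⟨i, rfl⟩)), ?_⟩
      -- As `t ≤ N`, the middle of `0`, `N` and `t` is `t`.
      have := (hγ i).median 0 N t
      rw [LQC.middle_zero ht, dist_comm] at this
      exact this.le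
    · exact .inl (LQC.mem_truncation.2 (.inl ⟨i, rfl⟩))
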